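/- **Setting.** A *rank $n$ core graph* is a finite connected metric graph without valence-one vertices whose fundamental group is free of rank $n$. Its *natural vertices* are the points of valence $>2$, and its *natural edges* are the edges between natural vertices (valence-two vertices being forgotten). A *fold* $f:G\to H$ is a quotient map of metric graphs of the following form: for two directed natural edges of $G$ with a common initial vertex $v$, and arc-length parametrizations $l_1,l_2$ of their initial segments of some length $L>0$, with $l_1(0)=l_2(0)=v$ and $l_1((0,L])\cap l_2((0,L])=\emptyset$, $f$ identifies $l_1(t)$ with $l_2(t)$ for all $t\in[0,L]$, makes no other identification, and preserves arc length. A *split sequence of rank $n$* is a sequence of folds $\zeta: G_0\xleftarrow{f_{-1}}G_{-1}\xleftarrow{f_{-2}}G_{-2}\leftarrow\cdots$ between rank $n$ core graphs such that each composition $f^j_0:G_j\to G_0$ ($j<0$) is locally injective away from the natural vertices of $G_j$; write $f^k_j:G_k\to G_j$ for the compositions ($k\le j\le 0$). It is *proper* if $\{f^j_0(v): j<0,\ v \text{ a natural vertex of } G_j\}$ is finite. The *solenoid* $X=X(\zeta)$ is the inverse limit of $\zeta$ in topological spaces, with projections $\pi_j:X\to G_j$. **Standard neighborhoods, plaques,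 singularities.** For $n\ge2$, an *$n$-pronged star set* is a homeomorphic image of $n$ copies of $[0,1)$ glued at $0$; the image of $0$ is its *center*, the images of the copies of $(0,1)$ are its *prongs*, and a *turn* of it is the union of its center and two distinct prongs. A point $p\in G_k$ is *special* if $f^k_j(p)$ is a natural vertex of $G_j$ for some $j\ge k$, or $p=f^j_k(v)$ for some $j\le k$ and some natural vertex $v$ of $G_j$. A *standard star neighborhood* in $G_j$ is an open star set with no special points except possibly its center; a *standard turn* is a turn of one; a *standard neighborhood* in $X$ is a set $\pi_j^{-1}(V)$ with $V$ a standard star neighborhood in $G_j$; a *standard plaque* is a path component of a standard neighborhood. A point $x\in X$ is a *singularity* ($x\in \mathrm{Sing}(X)$) if for each standard neighborhood $O\ni x$ the path component of $x$ in $O$ is a star set with more than two prongs. A standard plaque is *singular* if it is a star set centered at a singularity, otherwise *non-singular*. A *leaf segment* is a non-singular plaque that is a turn of a standard plaque; a *singular segment* is a turn of a singular plaque. A leaf segment (resp. singular segment) $L$ *takes* (resp. *sustains*) $I\subseteq G_k$ if there is a homeomorphism $l:I\to L$ with $\pi_k\circ l=\mathrm{id}_I$. A *pre-singularity* is a point $x\in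 X$ such that $\pi_j(x)$ is a natural vertex for all sufficiently negative $j$. **Stabilized.** A proper split sequence is *stabilized* if: (1) for each $j$ and each natural vertex $q$ of $G_j$, $\pi_j^{-1}(q)$ contains at most one pre-singularity; (2) for each $j$ and each $q\in G_j$ that is not a natural vertex, $\pi_j^{-1}(q)$ contains no pre-singularity; (3) for each standard turn $I$ in a level graph $G_k$ there is no 3-pronged star set $U\subseteq X$ with $\pi_k(U)=I$; (4) for each standard turn $I$ in a level graph $G_k$ and each singular segment $L$ sustaining $I$, exactly one of the following holds: for every $j\le0$ some leaf segment takes $\pi_j(L)$; or no leaf segment takes $\pi_0(L)$. **Partial leaves.** An *optimal point* of $G_0$ is a special point or the mid-point of a natural edge that is a loop. An *optimal star neighborhood* in $G_0$ is a standard star neighborhood that is centered at an optimal point, contains no other optimal point, and is maximal among those with the same center. An *optimal leaf segment* is a non-singular path component of $\pi_0^{-1}(V)$ for some optimal star neighborhood $V$ in $G_0$. A *concatenation of leaf segments* is a finite union $L_1\cup\dots\cup L_m$ of optimal leaf segments such that each $L_i\cap L_{i+1}$ contains a leaf segment. Two points of $X\setminus\mathrm{Sing}(X)$ are *leaf equivalent*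 if some concatenation of leaf segments contains both, and a *partial leaf* of $X$ is a leaf equivalence class of $X\setminus \mathrm{Sing}(X)$. The solenoid $X$ is *minimal* if each partial leaf is dense in $X$. **Full mingling.** For $k<j\le 0$, a natural edge $E$ of $G_k$ *mingles* with a natural edge $E'$ of $G_j$ if $f^k_j(\mathrm{int}\,E)\cap \mathrm{int}\,E'\neq\emptyset$. The sequence $\zeta$ is *fully mingling* if for each $j\le0$ there is $k<j$ such that each natural edge of $G_k$ mingles with each natural edge of $G_j$. **Proposition (The Mingling Lemma).** Let $\zeta$ be a proper stabilized split sequence of rank $n$. If $\zeta$ is fully mingling, then the solenoid $X(\zeta)$ is minimal. -/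

import Mathlib

open Set Topology

namespace Solenoids

/-! ### Finite metric graphs -/

/-- A finite metric graph, presented by its natural cell structure: a Hausdorff space that is a
finite one-dimensional cell complex, with vertex set `vert`, whose (undirected) edge `e` has length
`len e` and is parametrised by arc length by `chart e` on `[0, len e]`.  (Since the space is
Hausdorff and there are finitely many cells, it carries the usual topology of a graph.)  In the
level graphs below every vertex has valence at least three, so that `vert` is exactly the set of
natural vertices and `Edge` is exactly the set of natural edges. -/
structure MetricGraph where
  Point : Type*
  [top : TopologicalSpace Point]
  [t2 : T2Space Point]
  vert : Set Point
  vert_finite : vert.Finite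
  Edge : Type
  [fintypeEdge : Fintype Edge]
  len : Edge → ℝ
  len_pos : ∀ e, 0 < len e
  chart : Edge → ℝ → Point
  chart_continuousOn : ∀ e, ContinuousOn (chart e) (Icc 0 (len e))
  chart_zero : ∀ e, chart e 0 ∈ vert
  chart_len : ∀ e, chart e (len e) ∈ vert
  chart_notMem_vert : ∀ e, ∀ s ∈ Ioo 0 (len e), chart e s ∉ vert
  chart_inj : ∀ e e', ∀ s ∈ Ioo 0 (len e), ∀ s' ∈ Ioo 0 (len e'),
    chart e s = chart e' s' → e = e' ∧ s = s'
  cover : ∀ p, p ∈ vert ∨ ∃ e, ∃ s ∈ Ioo 0 (len e), chart e s = p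

attribute [instance] MetricGraph.top MetricGraph.t2 MetricGraph.fintypeEdge

namespace MetricGraph

/-- The interior of an edge. -/
def edgeInterior (G : MetricGraph) (e : G.Edge) : Set G.Point :=
  G.chart e '' Ioo 0 (G.len e)

/-- Arc length parametrisation of a directed edge, starting at its initial vertex; `(e, true)` is
`e` with the direction of its chart and `(e, false)` is `e` with the opposite direction. -/
def path (G : MetricGraph) (d : G.Edge × Bool) (t : ℝ) : G.Point :=
  if d.2 then G.chart d.1 t else G.chart d.1 (G.len d.1 - t)

/-- The valence of a vertex: the number of directed edges that start at it. -/
noncomputable def valence (G : MetricGraph) (v : G.Point) : ℕ :=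
  Nat.card {d : G.Edge × Bool // G.path d 0 = v}

/-- A core graph of rank `n`, in its natural cell structure: a finite connected graph, all of whose
vertices have valence at least three, with Euler characteristic `1 - n`, so that its fundamental
group is free of rank `n`. -/
structure IsCore (G : MetricGraph) (n : ℕ) : Prop where
  connected : ConnectedSpace G.Point
  three_le_valence : ∀ v ∈ G.vert, 3 ≤ G.valence v
  rank : Fintype.card G.Edge + 1 = G.vert.ncard + n

/-- `f : G → H` is a fold: for two directed edges `d₁`, `d₂` with the same initial vertex, and for
their initial segments of some length `L > 0`, which are disjoint away from the initial vertex,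
`f` is the quotient map that identifies the points at distance `t ∈ [0, L]` from the initial vertex
along the two segments, and makes no other identification.  The last clause says that `f`
preserves arc length. -/
def IsFold (G H : MetricGraph) (f : G.Point → H.Point) : Prop :=
  IsQuotientMap f ∧
  (∃ (d₁ d₂ : G.Edge × Bool) (L : ℝ),
    G.path d₁ 0 = G.path d₂ 0 ∧
    0 < L ∧ L ≤ G.len d₁.1 ∧ L ≤ G.len d₂.1 ∧
    Disjoint (G.path d₁ '' Ioc 0 L) (G.path d₂ '' Ioc 0 L) ∧
    ∀ x y, f x = f y ↔
      x = y ∨ ∃ t ∈ Icc 0 L,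
        (x = G.path d₁ t ∧ y = G.path d₂ t) ∨ (x = G.path d₂ t ∧ y = G.path d₁ t)) ∧
  ∀ (d : G.Edge × Bool) (t : ℝ), 0 ≤ t → t < G.len d.1 →
    ∃ (ε : ℝ) (d' : H.Edge × Bool) (u : ℝ),
      0 < ε ∧ t + ε ≤ G.len d.1 ∧ 0 ≤ u ∧ u + ε ≤ H.len d'.1 ∧
      ∀ s ∈ Icc 0 ε, f (G.path d (t + s)) = H.path d' (u + s)

end MetricGraph

/-! ### Star sets -/

/-- The model `n`-pronged star: `n` half-open intervals `[0, 1)` glued at `0`, realised as the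
union of the segments `[0, 1)` of the coordinate axes of `ℝⁿ`. -/
def Star (n : ℕ) : Set (Fin n → ℝ) :=
  {x | ∃ i, ∃ t ∈ Ico (0 : ℝ) 1, x = Pi.single i t}

/-- The turn of the model star through the prongs `i` and `k`: these two (open) prongs together
with the center. -/
def starTurn (n : ℕ) (i k : Fin n) : Set (Star n) :=
  {x | ∃ t ∈ Ico (0 : ℝ) 1, (x : Fin n → ℝ) = Pi.single i t ∨ (x : Fin n → ℝ) = Pi.single k t}

/-- `S` is an `n`-pronged star set of `Y` centered at `c`. -/
def IsStarSet {Y : Type*} [TopologicalSpace Y] (n : ℕ) (S : Set Y) (c : Y) : Prop :=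
  2 ≤ n ∧ ∃ h : Star n ≃ₜ S, ∀ x : Star n, (x : Fin n → ℝ) = 0 → (h x : Y) = c

/-- `T` is a turn of the star set `S`: the union of two distinct open prongs and the center. -/
def IsTurnOf {Y : Type*} [TopologicalSpace Y] (T S : Set Y) : Prop :=
  ∃ n, 2 ≤ n ∧ ∃ h : Star n ≃ₜ S, ∃ i k : Fin n, i ≠ k ∧
    T = (fun x => (h x : Y)) '' starTurn n i k

/-! ### Split sequences and their solenoids -/

/-- An inverse sequence `G₀ ← G₁ ← G₂ ← ⋯` of metric graphs.  The level `j` here is the level `-j`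
of a sequence indexed by the non-positive integers. -/
structure GraphSequence where
  G : ℕ → MetricGraph
  f : ∀ j, (G (j + 1)).Point → (G j).Point

namespace GraphSequence

/-- The composition `G_k → G_{k-1} → ⋯ → G_j`. -/
def comp (ζ : GraphSequence) {j k : ℕ} (h : j ≤ k) : (ζ.G k).Point → (ζ.G j).Point :=
  Nat.leRecOn (C := fun i => (ζ.G i).Point → (ζ.G j).Point) h (fun g x => g (ζ.f _ x)) id

theorem comp_self (ζ : GraphSequence) (j : ℕ) : ζ.comp (le_refl j) = id :=
  Nat.leRecOn_self _

theorem comp_succ (ζ : GraphSequence) {j k : ℕ} (h : j ≤ k) (x : (ζ.G (k + 1)).Point) :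
    ζ.comp (Nat.le_succ_of_le h) x = ζ.comp h (ζ.f k x) := by
  unfold comp
  rw [Nat.leRecOn_succ h]

/-- A split sequence of rank `n`: a sequence of folds between core graphs of rank `n`, such that
all compositions to level `0` have no backtracking, i.e. are locally injective away from the
natural vertices. -/
structure IsSplitSequence (ζ : GraphSequence) (n : ℕ) : Prop where
  core : ∀ j, (ζ.G j).IsCore n
  fold : ∀ j, MetricGraph.IsFold (ζ.G (j + 1)) (ζ.G j) (ζ.f j)
  noBacktracking : ∀ j, ∀ x ∉ (ζ.G j).vert, ∃ U ∈ 𝓝 x, InjOn (ζ.comp (Nat.zero_le j)) U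

/-- Properness: the images in `G₀` of all the natural vertices of the deeper level graphs form a
finite set. -/
def IsProper (ζ : GraphSequence) : Prop :=
  {p : (ζ.G 0).Point | ∃ j, 0 < j ∧ ∃ v ∈ (ζ.G j).vert, ζ.comp (Nat.zero_le j) v = p}.Finite

/-- The solenoid: the inverse limit, with the subspace topology of the product. -/
def X (ζ : GraphSequence) : Type _ :=
  {x : ∀ j, (ζ.G j).Point // ∀ j, ζ.f j (x (j + 1)) = x j}

instance (ζ : GraphSequence) : TopologicalSpace ζ.X :=
  inferInstanceAs (TopologicalSpace {x : ∀ j, (ζ.G j).Point // ∀ j, ζ.f j (x (j + 1)) = x j})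

/-- The projection of the solenoid to the level `j` graph. -/
def proj (ζ : GraphSequence) (j : ℕ) (x : ζ.X) : (ζ.G j).Point := x.1 j

/-! ### Standard neighborhoods, plaques and singularities -/

/-- A point of `G_k` is special if one of its images in the shallower levels is a natural vertex,
or one of its preimages in the deeper levels is. -/
def IsSpecial (ζ : GraphSequence) (k : ℕ) (p : (ζ.G k).Point) : Prop :=
  (∃ (j : ℕ) (h : j ≤ k), ζ.comp h p ∈ (ζ.G j).vert) ∨
  (∃ (j : ℕ) (h : k ≤ j), ∃ v ∈ (ζ.G j).vert, ζ.comp h v = p)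

/-- `V` is a standard star neighborhood of `G_j` with center `p`: an open star set without special
points other than, possibly, its center. -/
def IsStdStarNhd (ζ : GraphSequence) (j : ℕ) (V : Set (ζ.G j).Point) (p : (ζ.G j).Point) : Prop :=
  IsOpen V ∧ (∃ n, IsStarSet n V p) ∧ ∀ q ∈ V, q ≠ p → ¬ ζ.IsSpecial j q

/-- `I` is a level `j` standard turn. -/
def IsStdTurn (ζ : GraphSequence) (j : ℕ) (I : Set (ζ.G j).Point) : Prop :=
  ∃ V p, ζ.IsStdStarNhd j V p ∧ IsTurnOf I V

/-- A standard neighborhood of the solenoid. -/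
def IsStdNhd (ζ : GraphSequence) (O : Set ζ.X) : Prop :=
  ∃ j V p, ζ.IsStdStarNhd j V p ∧ O = ζ.proj j ⁻¹' V

/-- A standard plaque: a path component of a standard neighborhood. -/
def IsStdPlaque (ζ : GraphSequence) (V : Set ζ.X) : Prop :=
  ∃ O, ζ.IsStdNhd O ∧ ∃ x ∈ O, V = pathComponentIn O x

/-- The set of singularities of the solenoid: the points `x` such that, for each standard
neighborhood `O` of `x`, the plaque of `O` through `x` is a star set with more than two prongs. -/
def Sing (ζ : GraphSequence) : Set ζ.X :=
  {x | ∀ O, ζ.IsStdNhd O → x ∈ O → ∃ n c, 2 < n ∧ IsStarSet n (pathComponentIn O x) c}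

/-- A singular plaque: a standard plaque that has a singularity as its center. -/
def IsSingularPlaque (ζ : GraphSequence) (V : Set ζ.X) : Prop :=
  ζ.IsStdPlaque V ∧ ∃ n, ∃ s ∈ ζ.Sing, IsStarSet n V s

/-- A non-singular plaque. -/
def IsNonsingularPlaque (ζ : GraphSequence) (V : Set ζ.X) : Prop :=
  ζ.IsStdPlaque V ∧ ¬ ζ.IsSingularPlaque V

/-- A pre-leaf segment: a turn of a standard plaque. -/
def IsPreLeafSegment (ζ : GraphSequence) (L : Set ζ.X) : Prop :=
  ∃ V, ζ.IsStdPlaque V ∧ IsTurnOf L V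

/-- A leaf segment: a pre-leaf segment that is a non-singular plaque. -/
def IsLeafSegment (ζ : GraphSequence) (L : Set ζ.X) : Prop :=
  ζ.IsPreLeafSegment L ∧ ζ.IsNonsingularPlaque L

/-- A singular segment: a turn of a singular plaque. -/
def IsSingularSegment (ζ : GraphSequence) (L : Set ζ.X) : Prop :=
  ∃ V, ζ.IsSingularPlaque V ∧ IsTurnOf L V

/-- `L` sustains `I`, for a (pre-)leaf segment `L` and a level `k` turn `I`: some homeomorphism
`I → L` is a section of the projection to level `k`.  If `L` is a leaf segment, `L` is also said to
take `I`. -/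
def Sustains (ζ : GraphSequence) (k : ℕ) (L : Set ζ.X) (I : Set (ζ.G k).Point) : Prop :=
  ∃ l : I ≃ₜ L, ∀ q : I, ζ.proj k (l q) = q

/-- The turn `I` is taken by the solenoid. -/
def IsTaken (ζ : GraphSequence) (k : ℕ) (I : Set (ζ.G k).Point) : Prop :=
  ∃ L, ζ.IsLeafSegment L ∧ ζ.Sustains k L I

/-- A pre-singularity: a point whose projections to all sufficiently deep levels are natural
vertices. -/
def IsPreSingularity (ζ : GraphSequence) (x : ζ.X) : Prop :=
  ∃ k, ∀ j, k ≤ j → ζ.proj j x ∈ (ζ.G j).vert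

/-- The stabilizing hypotheses. -/
structure IsStabilized (ζ : GraphSequence) : Prop where
  vertex_unique : ∀ j, ∀ q ∈ (ζ.G j).vert, ∀ x y, ζ.IsPreSingularity x → ζ.IsPreSingularity y →
    ζ.proj j x = q → ζ.proj j y = q → x = y
  vertex_none : ∀ j, ∀ q ∉ (ζ.G j).vert, ∀ x, ζ.IsPreSingularity x → ζ.proj j x ≠ q
  turn_no_star : ∀ k I, ζ.IsStdTurn k I → ¬ ∃ U c, IsStarSet 3 U c ∧ ζ.proj k '' U = I
  turn_taken : ∀ k I, ζ.IsStdTurn k I → ∀ L, ζ.IsSingularSegment L → ζ.Sustains k L I →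
    Xor (∀ j, ζ.IsTaken j (ζ.proj j '' L)) (¬ ζ.IsTaken 0 (ζ.proj 0 '' L))

/-! ### Partial leaves and minimality -/

/-- An optimal point of `G_j`: a special point, or the mid-point of a loop. -/
def IsOptimalPoint (ζ : GraphSequence) (j : ℕ) (p : (ζ.G j).Point) : Prop :=
  ζ.IsSpecial j p ∨
  ∃ e, (ζ.G j).chart e 0 = (ζ.G j).chart e ((ζ.G j).len e) ∧
    p = (ζ.G j).chart e ((ζ.G j).len e / 2)

/-- A pre-optimal star neighborhood with center `p`. -/
def IsPreOptimal (ζ : GraphSequence) (j : ℕ) (V : Set (ζ.G j).Point) (p : (ζ.G j).Point) : Prop :=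
  ζ.IsStdStarNhd j V p ∧ ζ.IsOptimalPoint j p ∧ ∀ q ∈ V, q ≠ p → ¬ ζ.IsOptimalPoint j q

/-- A level `j` optimal star neighborhood: a pre-optimal one that is maximal among those with the
same center. -/
def IsOptimalStarNhd (ζ : GraphSequence) (j : ℕ) (V : Set (ζ.G j).Point) : Prop :=
  ∃ p, ζ.IsPreOptimal j V p ∧ ∀ V', ζ.IsPreOptimal j V' p → V ⊆ V' → V' = V

/-- An optimal plaque: a path component of a level `0` optimal neighborhood of the solenoid. -/
def IsOptimalPlaque (ζ : GraphSequence) (V : Set ζ.X) : Prop :=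
  ∃ U, ζ.IsOptimalStarNhd 0 U ∧ ∃ x ∈ ζ.proj 0 ⁻¹' U, V = pathComponentIn (ζ.proj 0 ⁻¹' U) x

/-- An optimal leaf segment: a non-singular optimal plaque. -/
def IsOptimalLeafSegment (ζ : GraphSequence) (L : Set ζ.X) : Prop :=
  ζ.IsOptimalPlaque L ∧ ζ.IsNonsingularPlaque L

/-- `S` is a concatenation of leaf segments: a union of optimal leaf segments `L₀, …, L_{m-1}` such
that each `Lᵢ ∩ Lᵢ₊₁` contains a leaf segment. -/
def IsConcatenation (ζ : GraphSequence) (S : Set ζ.X) : Prop :=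
  ∃ (m : ℕ) (L : ℕ → Set ζ.X), (∀ i < m, ζ.IsOptimalLeafSegment (L i)) ∧
    (∀ i, i + 1 < m → ∃ M, ζ.IsLeafSegment M ∧ M ⊆ L i ∩ L (i + 1)) ∧
    S = ⋃ i < m, L i

/-- Leaf equivalence of non-singular points. -/
def LeafEquiv (ζ : GraphSequence) (x y : ζ.X) : Prop :=
  ∃ S, ζ.IsConcatenation S ∧ x ∈ S ∧ y ∈ S

/-- A partial leaf: a leaf equivalence class of `X ∖ Sing(X)`. -/
def IsPartialLeaf (ζ : GraphSequence) (L : Set ζ.X) : Prop :=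
  ∃ x ∉ ζ.Sing, L = {y | y ∉ ζ.Sing ∧ ζ.LeafEquiv x y}

/-- The solenoid is minimal: each partial leaf is dense. -/
def IsMinimal (ζ : GraphSequence) : Prop :=
  ∀ L, ζ.IsPartialLeaf L → Dense L

/-! ### Full mingling -/

/-- The edge `e` of `G_k` mingles with the edge `e'` of `G_j`, for a level `k` deeper than `j`. -/
def Mingles (ζ : GraphSequence) {j k : ℕ} (h : j < k) (e : (ζ.G k).Edge) (e' : (ζ.G j).Edge) :
    Prop :=
  (ζ.comp h.le '' (ζ.G k).edgeInterior e ∩ (ζ.G j).edgeInterior e').Nonempty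

/-- Full mingling: for each level `j` there is a deeper level `k` such that each natural edge of
`G_k` mingles with each natural edge of `G_j`. -/
def IsFullyMingling (ζ : GraphSequence) : Prop :=
  ∀ j, ∃ (k : ℕ) (h : j < k), ∀ e e', ζ.Mingles h e e'

end GraphSequence

end Solenoids

/-!
Fix a point `x` that is not a singularity.  Its partial leaf is dense because of the following
observation: as soon as the leaf enters the interior of a natural edge of some level graph `G_j`,
it runs through the whole edge (`IsSplitSequence.exists_leafChain_chart`).  Given this, choose by
full mingling a level `k` deeper than `j` such that each edge of `G_k` mingles with each edge of
`G_j`.  The leaf meets the interior of some edge of `G_k`, hence it runs through that edge, hence it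
enters every edge of `G_j`, hence it runs through every edge of `G_j`.  The preimages of open sets of
the level graphs form a basis of the solenoid, and so the leaf is dense.

The observation rests on the second stabilizing condition: a point of the solenoid over an interior
point of an edge is not a pre-singularity, so at infinitely many levels it is not a vertex.  At
these levels both directions of the edge lift, because folds have unit speed and the compositions
do not backtrack, and the lifts continue as long as no vertex is met
(`IsUnitSpeed.extend`).  At each level there are finitely many lifts, so Kőnig's lemma
gives a lift to the solenoid (`IsSplitSequence.exists_lift`).

To turn such lifts into concatenations of optimal leaf segments, the following facts are used.
* There are finitely many optimal points, and the optimal star neighborhood of an optimal point `p`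
  is the component of `p` in the complement of the other optimal points
  (`IsCore.exists_maximal_star`).
* A plaque contains at most one point over the center of its neighborhood: a path between two such
  points would, at some level, run through an arc of an edge whose image is a loop at the center
  (`IsUnitSpeed.eq_of_path_over`); the mid-points of loops are optimal in order to exclude this.
* Consequently the plaques of arcs of open edges embed in these arcs, so a singularity is a vertex
  at every level, and the optimal plaque of a non-singular point over an optimal point is
  non-singular (`IsSplitSequence.isOptimalLeafSegment`).
* Two optimal leaf segments with a common point have a common leaf segment, so that chains of them
  can be composed (`IsSplitSequence.leafChain_trans`).
* Each point over no optimal point lies in some optimal leaf segment: by full mingling it lies on a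
  deep edge that passes over a vertex of `G_0`
  (`IsSplitSequence.exists_optimalLeafSegment_mem`).
-/

namespace Solenoids

namespace MetricGraph

variable {G H : MetricGraph}

/-! ### The topology of a finite metric graph -/

/-- The graph carries the quotient topology of its cells: finitely many compact cells cover it. -/
theorem isClosed_of_chart {S : Set G.Point}
    (h : ∀ e, IsClosed {u : ℝ | u ∈ Icc 0 (G.len e) ∧ G.chart e u ∈ S}) : IsClosed S := by
  have hS : S = (S ∩ G.vert) ∪ ⋃ e, G.chart e '' {u | u ∈ Icc 0 (G.len e) ∧ G.chart e u ∈ S} := by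
    ext p
    constructor
    · intro hp
      rcases G.cover p with hv | ⟨e, s, hs, rfl⟩
      · exact Or.inl ⟨hp, hv⟩
      · exact Or.inr (mem_iUnion.2 ⟨e, s, ⟨Ioo_subset_Icc_self hs, hp⟩, rfl⟩)
    · rintro (hp | hp)
      · exact hp.1
      · obtain ⟨e, u, hu, rfl⟩ := mem_iUnion.1 hp
        exact hu.2
  rw [hS]
  refine IsClosed.union ((G.vert_finite.subset inter_subset_right).isClosed)
    (isClosed_iUnion_of_finite fun e => IsCompact.isClosed ?_)
  exact (isCompact_Icc.of_isClosed_subset (h e) (fun u hu => hu.1)).image_of_continuousOn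
    ((G.chart_continuousOn e).mono fun u hu => hu.1)

theorem isOpen_of_chart {W : Set G.Point}
    (h : ∀ e, ∀ u ∈ Icc 0 (G.len e), G.chart e u ∈ W →
      ∀ᶠ u' in 𝓝[Icc 0 (G.len e)] u, G.chart e u' ∈ W) : IsOpen W := by
  rw [← isClosed_compl_iff]
  refine isClosed_of_chart fun e => ?_
  rw [← isOpen_compl_iff, isOpen_iff_mem_nhds]
  intro u hu
  by_cases hI : u ∈ Icc 0 (G.len e)
  · have hW : G.chart e u ∈ W := by
      by_contra hc
      exact hu ⟨hI, hc⟩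
    filter_upwards [eventually_nhdsWithin_iff.1 (h e u hI hW)] with u' h1 h2
    exact h2.2 (h1 h2.1)
  · filter_upwards [isClosed_Icc.isOpen_compl.mem_nhds hI] with u' h1 h2
    exact h1 h2.1

theorem mem_Ioo_of_chart_notMem_vert {e : G.Edge} {u : ℝ} (hu : u ∈ Icc 0 (G.len e))
    (h : G.chart e u ∉ G.vert) : u ∈ Ioo 0 (G.len e) := by
  refine ⟨lt_of_le_of_ne hu.1 ?_, lt_of_le_of_ne hu.2 ?_⟩
  · rintro rfl
    exact h (G.chart_zero e)
  · rintro rfl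
    exact h (G.chart_len e)

theorem isOpen_image_chart (e : G.Edge) {O : Set ℝ} (hO : IsOpen O) (hsub : O ⊆ Ioo 0 (G.len e)) :
    IsOpen (G.chart e '' O) := by
  refine isOpen_of_chart fun e' u hu hW => ?_
  obtain ⟨s, hs, hse⟩ := hW
  have hu' : u ∈ Ioo 0 (G.len e') := by
    refine mem_Ioo_of_chart_notMem_vert hu ?_
    rw [← hse]
    exact G.chart_notMem_vert e s (hsub hs)
  obtain ⟨rfl, rfl⟩ := G.chart_inj e e' s (hsub hs) u hu' hse
  filter_upwards [mem_nhdsWithin_of_mem_nhds (hO.mem_nhds hs)] with u' h'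
  exact ⟨u', h', rfl⟩

theorem isOpen_edgeInterior (e : G.Edge) : IsOpen (G.edgeInterior e) :=
  isOpen_image_chart e isOpen_Ioo subset_rfl

theorem chart_injOn (e : G.Edge) : InjOn (G.chart e) (Ioo 0 (G.len e)) :=
  fun _ hs _ hs' h => (G.chart_inj e e _ hs _ hs' h).2

/-- The arc length coordinate on the interior of an edge. -/
noncomputable def coord (G : MetricGraph) (e : G.Edge) : G.Point → ℝ :=
  Function.invFunOn (G.chart e) (Ioo 0 (G.len e))

theorem coord_mem {e : G.Edge} {p : G.Point} (hp : p ∈ G.edgeInterior e) :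
    G.coord e p ∈ Ioo 0 (G.len e) :=
  Function.invFunOn_mem hp

theorem chart_coord {e : G.Edge} {p : G.Point} (hp : p ∈ G.edgeInterior e) :
    G.chart e (G.coord e p) = p :=
  Function.invFunOn_eq hp

theorem coord_chart {e : G.Edge} {u : ℝ} (hu : u ∈ Ioo 0 (G.len e)) :
    G.coord e (G.chart e u) = u :=
  chart_injOn e (coord_mem ⟨u, hu, rfl⟩) hu (chart_coord ⟨u, hu, rfl⟩)

theorem continuousOn_coord (e : G.Edge) : ContinuousOn (G.coord e) (G.edgeInterior e) := by
  rintro p ⟨u, hu, rfl⟩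
  refine ContinuousAt.continuousWithinAt ?_
  intro N hN
  rw [coord_chart hu] at hN
  obtain ⟨O, hON, hO, huO⟩ := mem_nhds_iff.1 hN
  rw [Filter.mem_map]
  refine Filter.mem_of_superset ((isOpen_image_chart e (hO.inter isOpen_Ioo)
    inter_subset_right).mem_nhds ⟨u, ⟨huO, hu⟩, rfl⟩) ?_
  rintro _ ⟨u', hu', rfl⟩
  rw [mem_preimage, coord_chart hu'.2]
  exact hON hu'.1

theorem edgeInterior_disjoint_vert {e : G.Edge} {p : G.Point} (hp : p ∈ G.edgeInterior e) :
    p ∉ G.vert := by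
  obtain ⟨u, hu, rfl⟩ := hp
  exact G.chart_notMem_vert e u hu

theorem exists_edgeInterior {p : G.Point} (hp : p ∉ G.vert) : ∃ e, p ∈ G.edgeInterior e := by
  rcases G.cover p with hv | ⟨e, s, hs, rfl⟩
  · exact absurd hv hp
  · exact ⟨e, s, hs, rfl⟩

theorem edge_unique {e e' : G.Edge} {p : G.Point} (h : p ∈ G.edgeInterior e)
    (h' : p ∈ G.edgeInterior e') : e = e' := by
  obtain ⟨u, hu, rfl⟩ := h
  obtain ⟨u', hu', h⟩ := h'
  exact (G.chart_inj e e' u hu u' hu' h.symm).1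

theorem subset_edgeInterior_of_isPreconnected {C : Set G.Point} (hC : IsPreconnected C)
    (hv : ∀ p ∈ C, p ∉ G.vert) {e : G.Edge} {p : G.Point} (hp : p ∈ C)
    (hpe : p ∈ G.edgeInterior e) : C ⊆ G.edgeInterior e := by
  refine hC.subset_left_of_subset_union (v := ⋃ e' ∈ {e' | e' ≠ e}, G.edgeInterior e')
    (isOpen_edgeInterior e)
    (isOpen_biUnion fun e' _ => isOpen_edgeInterior e') ?_ ?_ ⟨p, hp, hpe⟩
  · rw [Set.disjoint_left]
    intro q hq hq'
    simp only [mem_iUnion] at hq'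
    obtain ⟨e', he', hq'⟩ := hq'
    exact he' (edge_unique hq' hq)
  · intro q hq
    obtain ⟨e', he'⟩ := exists_edgeInterior (hv q hq)
    by_cases h : e' = e
    · exact Or.inl (h ▸ he')
    · exact Or.inr (mem_biUnion (show e' ∈ {e' | e' ≠ e} from h) he')

/-- A connected subset of an open edge contains the open arc between any two of its limit
points. -/
theorem exists_arc_of_isPreconnected {C : Set G.Point} (hC : IsPreconnected C) {e : G.Edge}
    (hCe : C ⊆ G.edgeInterior e) {a b : G.Point} (ha : a ∈ closure C) (hb : b ∈ closure C) :
    ∃ u ∈ Icc 0 (G.len e), ∃ v ∈ Icc 0 (G.len e), G.chart e u = a ∧ G.chart e v = b ∧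
      ∀ w, (w ∈ Ioo u v ∨ w ∈ Ioo v u) → w ∈ Ioo 0 (G.len e) ∧ G.chart e w ∈ C := by
  set K := G.coord e '' C with hK
  have hKI : K ⊆ Ioo 0 (G.len e) := by
    rintro _ ⟨p, hp, rfl⟩
    exact coord_mem (hCe hp)
  have hKC : IsPreconnected K := hC.image _ ((continuousOn_coord e).mono hCe)
  have hKchart : ∀ w ∈ K, G.chart e w ∈ C := by
    rintro _ ⟨p, hp, rfl⟩
    rwa [chart_coord (hCe hp)]
  have hcl : closure K ⊆ Icc 0 (G.len e) :=
    closure_minimal (hKI.trans Ioo_subset_Icc_self) isClosed_Icc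
  have hlim : ∀ p ∈ closure C, ∃ u ∈ closure K, G.chart e u = p := by
    have hcomp : IsCompact (G.chart e '' closure K) :=
      (isCompact_Icc.of_isClosed_subset isClosed_closure hcl).image_of_continuousOn
        ((G.chart_continuousOn e).mono hcl)
    intro p hp
    refine closure_minimal ?_ hcomp.isClosed hp
    intro q hq
    exact ⟨G.coord e q, subset_closure ⟨q, hq, rfl⟩, chart_coord (hCe hq)⟩
  obtain ⟨u, hu, rfl⟩ := hlim a ha
  obtain ⟨v, hv, rfl⟩ := hlim b hb
  have key : ∀ x ∈ closure K, ∀ y ∈ closure K, Ioo x y ⊆ K := by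
    intro x hx y hy w hw
    obtain ⟨x', hx', hx'K⟩ := mem_closure_iff.1 hx (Iio w) isOpen_Iio hw.1
    obtain ⟨y', hy', hy'K⟩ := mem_closure_iff.1 hy (Ioi w) isOpen_Ioi hw.2
    exact hKC.ordConnected.out hx'K hy'K ⟨le_of_lt hx', le_of_lt hy'⟩
  refine ⟨u, hcl hu, v, hcl hv, rfl, rfl, ?_⟩
  rintro w (hw | hw)
  · have := key u hu v hv hw
    exact ⟨hKI this, hKchart w this⟩
  · have := key v hv u hu hw
    exact ⟨hKI this, hKchart w this⟩

/-! ### Directed edges -/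

/-- The directed edge with the opposite direction. -/
def rev {α : Type*} (d : α × Bool) : α × Bool := (d.1, !d.2)

@[simp] theorem rev_fst {α : Type*} (d : α × Bool) : (rev d).1 = d.1 := rfl

@[simp] theorem rev_rev {α : Type*} (d : α × Bool) : rev (rev d) = d := by
  simp [rev]

theorem path_rev (d : G.Edge × Bool) (u : ℝ) : G.path (rev d) u = G.path d (G.len d.1 - u) := by
  obtain ⟨e, b⟩ := d
  cases b <;> simp [path, rev]

theorem path_true (e : G.Edge) (u : ℝ) : G.path (e, true) u = G.chart e u := by simp [path]

theorem path_false (e : G.Edge) (u : ℝ) : G.path (e, false) u = G.chart e (G.len e - u) := by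
  simp [path]

theorem path_continuousOn (d : G.Edge × Bool) :
    ContinuousOn (G.path d) (Icc 0 (G.len d.1)) := by
  obtain ⟨e, b⟩ := d
  cases b
  · have : G.path (e, false) = fun u => G.chart e (G.len e - u) := by
      ext u; exact path_false e u
    rw [this]
    refine (G.chart_continuousOn e).comp (by fun_prop) ?_
    intro u hu
    constructor <;> linarith [hu.1, hu.2]
  · have : G.path (e, true) = G.chart e := by ext u; exact path_true e u
    rw [this]
    exact G.chart_continuousOn e

theorem path_zero_mem (d : G.Edge × Bool) : G.path d 0 ∈ G.vert := by
  obtain ⟨e, b⟩ := d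
  cases b
  · simpa [path] using G.chart_len e
  · simpa [path] using G.chart_zero e

theorem path_len_mem (d : G.Edge × Bool) : G.path d (G.len d.1) ∈ G.vert := by
  obtain ⟨e, b⟩ := d
  cases b
  · simpa [path] using G.chart_zero e
  · simpa [path] using G.chart_len e

theorem path_mem_edgeInterior (d : G.Edge × Bool) {u : ℝ} (hu : u ∈ Ioo 0 (G.len d.1)) :
    G.path d u ∈ G.edgeInterior d.1 := by
  obtain ⟨e, b⟩ := d
  cases b
  · rw [path_false]
    exact ⟨_, ⟨by linarith [hu.2], by linarith [hu.1]⟩, rfl⟩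
  · rw [path_true]
    exact ⟨_, hu, rfl⟩

theorem path_notMem_vert (d : G.Edge × Bool) {u : ℝ} (hu : u ∈ Ioo 0 (G.len d.1)) :
    G.path d u ∉ G.vert :=
  edgeInterior_disjoint_vert (path_mem_edgeInterior d hu)

theorem mem_Ioo_of_path_notMem_vert {d : G.Edge × Bool} {u : ℝ} (hu : u ∈ Icc 0 (G.len d.1))
    (h : G.path d u ∉ G.vert) : u ∈ Ioo 0 (G.len d.1) := by
  refine ⟨lt_of_le_of_ne hu.1 ?_, lt_of_le_of_ne hu.2 ?_⟩
  · rintro rfl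
    exact h (G.path_zero_mem d)
  · rintro rfl
    exact h (G.path_len_mem d)

theorem path_injOn (d : G.Edge × Bool) : InjOn (G.path d) (Ioo 0 (G.len d.1)) := by
  obtain ⟨e, b⟩ := d
  intro u hu v hv h
  cases b
  · simp only [path_false] at h
    have := chart_injOn e (⟨by linarith [hu.2], by linarith [hu.1]⟩)
      (⟨by linarith [hv.2], by linarith [hv.1]⟩) h
    linarith
  · simp only [path_true] at h
    exact chart_injOn e hu hv h

/-- A point in the interior of an edge lies on exactly two directed edges, with opposite
directions. -/
theorem path_eq_path {d d' : G.Edge × Bool} {u u' : ℝ} (hu : u ∈ Ioo 0 (G.len d.1))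
    (hu' : u' ∈ Icc 0 (G.len d'.1)) (h : G.path d u = G.path d' u') :
    (d' = d ∧ u' = u) ∨ (d' = rev d ∧ u' = G.len d.1 - u) := by
  have hu'' : u' ∈ Ioo 0 (G.len d'.1) :=
    mem_Ioo_of_path_notMem_vert hu' (h ▸ path_notMem_vert d hu)
  have he : d.1 = d'.1 :=
    edge_unique (path_mem_edgeInterior d hu) (h ▸ path_mem_edgeInterior d' hu'')
  have hd : d' = d ∨ d' = rev d := by
    obtain ⟨e, b⟩ := d
    obtain ⟨e', b'⟩ := d'
    obtain rfl : e = e' := he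
    cases b <;> cases b' <;> simp [rev]
  rcases hd with rfl | rfl
  · exact Or.inl ⟨rfl, (path_injOn _ hu hu'' h).symm⟩
  · refine Or.inr ⟨rfl, ?_⟩
    rw [path_rev] at h
    have := path_injOn _ hu (by
      rw [rev_fst] at hu''
      exact ⟨by linarith [hu''.2], by linarith [hu''.1]⟩) h
    linarith

theorem finite_path_preimage (d : G.Edge × Bool) {S : Set G.Point} (hS : S.Finite) :
    {u | u ∈ Icc 0 (G.len d.1) ∧ G.path d u ∈ S}.Finite := by
  have h1 : (Ioo 0 (G.len d.1) ∩ G.path d ⁻¹' S).Finite := by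
    refine Set.Finite.of_finite_image (f := G.path d) (hS.subset ?_)
      ((path_injOn d).mono inter_subset_left)
    rintro _ ⟨u, hu, rfl⟩
    exact hu.2
  refine (h1.union (Set.toFinite {0, G.len d.1})).subset ?_
  rintro u ⟨hu, huS⟩
  by_cases h : u ∈ Ioo 0 (G.len d.1)
  · exact Or.inl ⟨h, huS⟩
  · right
    by_contra hc
    simp only [mem_insert_iff, mem_singleton_iff, not_or] at hc
    exact h ⟨lt_of_le_of_ne hu.1 (Ne.symm hc.1), lt_of_le_of_ne hu.2 hc.2⟩

theorem IsCore.nonempty_direction {n : ℕ} (hG : G.IsCore n) {v : G.Point} (hv : v ∈ G.vert) :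
    ∃ d, G.path d 0 = v := by
  have h := hG.three_le_valence v hv
  unfold valence at h
  by_contra hc
  push Not at hc
  have : IsEmpty {d : G.Edge × Bool // G.path d 0 = v} := ⟨fun d => hc d.1 d.2⟩
  rw [Nat.card_of_isEmpty] at h
  omega

theorem IsCore.exists_path {n : ℕ} (hG : G.IsCore n) (p : G.Point) :
    ∃ d u, 0 ≤ u ∧ u < G.len d.1 ∧ G.path d u = p := by
  rcases G.cover p with hv | ⟨e, s, hs, rfl⟩
  · obtain ⟨d, hd⟩ := hG.nonempty_direction hv
    exact ⟨d, 0, le_rfl, G.len_pos _, hd⟩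
  · exact ⟨(e, true), s, hs.1.le, hs.2, path_true e s⟩

/-- A nonempty open set of a core graph contains an interior point of an edge. -/
theorem IsCore.exists_chart_mem {n : ℕ}
    (hG : G.IsCore n) {W : Set G.Point} (hW : IsOpen W) {p : G.Point} (hp : p ∈ W) :
    ∃ e, ∃ t ∈ Ioo 0 (G.len e), G.chart e t ∈ W := by
  obtain ⟨d, u, hu, hul, rfl⟩ := hG.exists_path p
  have hmem : u ∈ closure (Ioo u (G.len d.1)) := by
    rw [closure_Ioo hul.ne]
    exact ⟨le_rfl, hul.le⟩
  have hc : ContinuousWithinAt (G.path d) (Ioo u (G.len d.1)) u :=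
    (path_continuousOn d u ⟨hu, hul.le⟩).mono fun t ht => ⟨hu.trans ht.1.le, ht.2.le⟩
  have := mem_closure_iff_nhdsWithin_neBot.1 hmem
  obtain ⟨t, htW, ht⟩ := ((hc.eventually (hW.mem_nhds hp)).and self_mem_nhdsWithin).exists
  obtain ⟨s, hs, hst⟩ := path_mem_edgeInterior d (u := t) ⟨hu.trans_lt ht.1, ht.2⟩
  exact ⟨d.1, s, hs, by rw [hst]; exact htW⟩

/-- Beyond the first, a core graph has a further edge: three directed edges start at a vertex. -/
theorem IsCore.exists_ne_edge {n : ℕ} (hG : G.IsCore n) (e : G.Edge) : ∃ e', e' ≠ e := by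
  by_contra hc
  push Not at hc
  have h := hG.three_le_valence _ (G.chart_zero e)
  unfold valence at h
  have h1 : Nat.card {d : G.Edge × Bool // G.path d 0 = G.chart e 0} ≤ Nat.card (G.Edge × Bool) :=
    Nat.card_le_card_of_injective _ Subtype.val_injective
  have h2 : Nat.card (G.Edge × Bool) ≤ 2 := by
    have : Nat.card G.Edge ≤ 1 := by
      rw [Finite.card_le_one_iff_subsingleton]
      exact ⟨fun a b => (hc a).trans (hc b).symm⟩
    rw [Nat.card_prod, Nat.card_eq_fintype_card (α := Bool), Fintype.card_bool]
    omega
  omega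

/-! ### Maps of unit speed -/

/-- `f` maps short initial segments of the directed edges, started at any point, isometrically to
segments of directed edges. -/
def IsUnitSpeed (f : G.Point → H.Point) : Prop :=
  ∀ (d : G.Edge × Bool) (t : ℝ), 0 ≤ t → t < G.len d.1 →
    ∃ (ε : ℝ) (d' : H.Edge × Bool) (u : ℝ),
      0 < ε ∧ t + ε ≤ G.len d.1 ∧ 0 ≤ u ∧ u + ε ≤ H.len d'.1 ∧
      ∀ s ∈ Icc 0 ε, f (G.path d (t + s)) = H.path d' (u + s)

theorem IsUnitSpeed.id : IsUnitSpeed (id : G.Point → G.Point) := by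
  intro d t h0 h1
  exact ⟨G.len d.1 - t, d, t, by linarith, by linarith, h0, by linarith, fun _ _ => rfl⟩

theorem IsUnitSpeed.comp {K : MetricGraph} {g : H.Point → K.Point} {f : G.Point → H.Point}
    (hg : IsUnitSpeed g) (hf : IsUnitSpeed f) : IsUnitSpeed (fun x => g (f x)) := by
  intro d t h0 h1
  obtain ⟨ε, d', u, hε, htε, hu, huε, hfe⟩ := hf d t h0 h1
  obtain ⟨δ, d'', w, hδ, huδ, hw, hwδ, hge⟩ := hg d' u hu (by linarith)
  refine ⟨min ε δ, d'', w, lt_min hε hδ, ?_, hw, ?_, ?_⟩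
  · linarith [min_le_left ε δ]
  · linarith [min_le_right ε δ]
  · intro s hs
    simp only
    rw [hfe s ⟨hs.1, hs.2.trans (min_le_left _ _)⟩, hge s ⟨hs.1, hs.2.trans (min_le_right _ _)⟩]

/-- `f` is locally injective away from the vertices. -/
def NoBacktracking (f : G.Point → H.Point) : Prop :=
  ∀ x ∉ G.vert, ∃ U ∈ 𝓝 x, InjOn f U

theorem path_continuousAt (d : G.Edge × Bool) {u : ℝ} (hu : u ∈ Ioo 0 (G.len d.1)) :
    ContinuousAt (G.path d) u :=
  (path_continuousOn d).continuousAt (Icc_mem_nhds hu.1 hu.2)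

/-- A map without backtracking does not reflect at an interior point of an edge. -/
theorem NoBacktracking.not_reflect {f : G.Point → H.Point} (hf : NoBacktracking f)
    {d : G.Edge × Bool} {u : ℝ} (hu : u ∈ Ioo 0 (G.len d.1)) {ε : ℝ} (hε : 0 < ε)
    (h : ∀ s ∈ Ioo 0 ε, f (G.path d (u + s)) = f (G.path d (u - s))) : False := by
  obtain ⟨U, hU, hinj⟩ := hf _ (path_notMem_vert d hu)
  have h0 : ∀ᶠ t in 𝓝 u, G.path d t ∈ U := path_continuousAt d hu hU
  have h1 : ∀ᶠ t in 𝓝 u, G.path d t ∈ U ∧ t ∈ Ioo 0 (G.len d.1) :=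
    h0.and (Ioo_mem_nhds hu.1 hu.2)
  obtain ⟨δ, hδ, hball⟩ := Metric.eventually_nhds_iff.1 h1
  set s := min ε δ / 2 with hs
  have hs0 : 0 < s := by positivity
  have hsε : s < ε := by
    have := min_le_left ε δ
    linarith
  have hsδ : s < δ := by
    have := min_le_right ε δ
    linarith
  obtain ⟨ha, ha'⟩ := hball (y := u + s) (by simpa [Real.dist_eq, abs_of_pos hs0] using hsδ)
  obtain ⟨hb, hb'⟩ := hball (y := u - s) (by simpa [Real.dist_eq, abs_of_pos hs0] using hsδ)
  have := path_injOn d ha' hb' (hinj ha hb (h s ⟨hs0, hsε⟩))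
  linarith

/-- A map of unit speed without backtracking that starts along the directed edge `d` as the
directed edge `d'` does, continues to do so until a vertex is met on either side. -/
theorem IsUnitSpeed.extend {f : G.Point → H.Point} (hf : IsUnitSpeed f) (hb : NoBacktracking f)
    (hc : Continuous f) {d : G.Edge × Bool} {d' : H.Edge × Bool} {u w r ε : ℝ}
    (hu : 0 ≤ u) (hud : u < G.len d.1) (hw : 0 ≤ w) (hwd : w < H.len d'.1) (hε : 0 < ε)
    (germ : ∀ s ∈ Icc 0 ε, f (G.path d (u + s)) = H.path d' (w + s)) (hr : 0 < r)
    (hv : ∀ s ∈ Ioo 0 r, u + s ≤ G.len d.1 → w + s ≤ H.len d'.1 →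
      f (G.path d (u + s)) = H.path d' (w + s) →
      G.path d (u + s) ∉ G.vert ∧ H.path d' (w + s) ∉ H.vert) :
    u + r ≤ G.len d.1 ∧ w + r ≤ H.len d'.1 ∧
      ∀ s ∈ Icc 0 r, f (G.path d (u + s)) = H.path d' (w + s) := by
  set P : ℝ → Prop := fun s => u + s ≤ G.len d.1 ∧ w + s ≤ H.len d'.1 ∧
    f (G.path d (u + s)) = H.path d' (w + s) with hP
  set A : Set ℝ := {x | ∀ s ∈ Icc 0 x, P s} with hA
  have hanti : ∀ x ∈ A, ∀ y ≤ x, y ∈ A := fun x hx y hyx s hs => hx s ⟨hs.1, hs.2.trans hyx⟩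
  have hclosed : IsClosed (A ∩ Icc 0 r) := by
    refine isClosed_of_closure_subset fun x hx => ?_
    have hxI : x ∈ Icc 0 r :=
      closure_minimal inter_subset_right isClosed_Icc hx
    refine ⟨?_, hxI⟩
    by_cases hxA : x ∈ A
    · exact hxA
    have hlt : ∀ s < x, s ∈ A := by
      intro s hs
      obtain ⟨y, hy, hyA⟩ := mem_closure_iff.1 hx (Ioi s) isOpen_Ioi hs
      exact hanti y hyA.1 s (le_of_lt hy)
    have hx0 : 0 < x := by
      rcases hxI.1.eq_or_lt with h | h
      · exfalso
        subst h
        obtain ⟨y, hyA⟩ := closure_nonempty_iff.1 ⟨_, hx⟩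
        exact hxA (hanti y hyA.1 0 hyA.2.1)
      · exact h
    have hPlt : ∀ s, 0 ≤ s → s < x → P s := fun s h0 h1 => hlt s h1 s ⟨h0, le_rfl⟩
    have hux : u + x ≤ G.len d.1 := by
      refine le_of_forall_lt fun c hc' => ?_
      have h1 := (hPlt (max 0 ((c - u + x) / 2)) (le_max_left _ _)
        (max_lt hx0 (by linarith))).1
      have h2 := le_max_right 0 ((c - u + x) / 2)
      linarith
    have hwx : w + x ≤ H.len d'.1 := by
      refine le_of_forall_lt fun c hc' => ?_
      have h1 := (hPlt (max 0 ((c - w + x) / 2)) (le_max_left _ _)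
        (max_lt hx0 (by linarith))).2.1
      have h2 := le_max_right 0 ((c - w + x) / 2)
      linarith
    have hF : ContinuousOn (fun s => f (G.path d (u + s))) (Icc 0 x) :=
      hc.comp_continuousOn ((path_continuousOn d).comp (by fun_prop) fun s hs =>
        ⟨by linarith [hs.1], by linarith [hs.2]⟩)
    have hK : ContinuousOn (fun s => H.path d' (w + s)) (Icc 0 x) :=
      (path_continuousOn d').comp (by fun_prop) fun s hs =>
        ⟨by linarith [hs.1], by linarith [hs.2]⟩
    have heq : EqOn (fun s => f (G.path d (u + s))) (fun s => H.path d' (w + s)) (Icc 0 x) := by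
      have h1 : EqOn (fun s => f (G.path d (u + s))) (fun s => H.path d' (w + s)) (Ico 0 x) :=
        fun s hs => (hPlt s hs.1 hs.2).2.2
      refine h1.of_subset_closure hF hK Ico_subset_Icc_self ?_
      rw [closure_Ico hx0.ne]
    intro s hs
    exact ⟨by linarith [hs.2], by linarith [hs.2], heq hs⟩
  have hzero : (0 : ℝ) ∈ A := by
    intro s hs
    obtain rfl : s = 0 := le_antisymm hs.2 hs.1
    exact ⟨by linarith, by linarith, germ 0 ⟨le_rfl, hε.le⟩⟩
  have hstep : ∀ x ∈ A ∩ Ico 0 r, A ∈ 𝓝[>] x := by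
    rintro x ⟨hxA, hx0, hxr⟩
    have hgerm : ∃ δ > 0, ∀ s ∈ Icc 0 δ, P (x + s) := by
      rcases hx0.eq_or_lt with rfl | hx0
      · refine ⟨min ε (min (G.len d.1 - u) (H.len d'.1 - w)),
          lt_min hε (lt_min (by linarith) (by linarith)), fun s hs => ?_⟩
        have h1 := hs.2.trans (min_le_left _ _)
        have h2 := hs.2.trans ((min_le_right _ _).trans (min_le_left _ _))
        have h3 := hs.2.trans ((min_le_right _ _).trans (min_le_right _ _))
        rw [zero_add]
        exact ⟨by linarith, by linarith, germ s ⟨hs.1, h1⟩⟩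
      · have hPx := hxA x ⟨hx0.le, le_rfl⟩
        obtain ⟨hv1, hv2⟩ := hv x ⟨hx0, hxr⟩ hPx.1 hPx.2.1 hPx.2.2
        have hI1 := mem_Ioo_of_path_notMem_vert ⟨by linarith, hPx.1⟩ hv1
        have hI2 := mem_Ioo_of_path_notMem_vert ⟨by linarith, hPx.2.1⟩ hv2
        obtain ⟨δ, d'', w', hδ, h1, hw', h2, h3⟩ := hf d (u + x) hI1.1.le hI1.2
        have h30 := h3 0 ⟨le_rfl, hδ.le⟩
        rw [add_zero, add_zero, hPx.2.2] at h30
        rcases path_eq_path hI2 ⟨hw', by linarith⟩ h30 with ⟨rfl, rfl⟩ | ⟨rfl, rfl⟩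
        · refine ⟨δ, hδ, fun s hs => ?_⟩
          have := h3 s hs
          rw [add_assoc, add_assoc] at this
          exact ⟨by linarith [hs.2], by linarith [hs.2], this⟩
        · exfalso
          refine hb.not_reflect hI1 (lt_min hδ hx0) fun s hs => ?_
          rw [h3 s ⟨hs.1.le, hs.2.le.trans (min_le_left _ _)⟩, path_rev]
          have h4 := (hxA (x - s) ⟨by linarith [hs.2, min_le_right δ x], by linarith [hs.1]⟩).2.2
          rw [show u + x - s = u + (x - s) by ring, h4]
          congr 1
          ring
    obtain ⟨δ, hδ, hδP⟩ := hgerm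
    have : Ioo x (x + δ) ∈ 𝓝[>] x := Ioo_mem_nhdsGT (by linarith)
    filter_upwards [this] with y hy s hs
    rcases le_or_gt s x with h | h
    · exact hxA s ⟨hs.1, h⟩
    · have := hδP (s - x) ⟨by linarith, by linarith [hs.2, hy.2]⟩
      rwa [add_sub_cancel] at this
  have hsub := hclosed.Icc_subset_of_forall_mem_nhdsWithin hzero hstep
  have hrA : r ∈ A := hsub ⟨hr.le, le_rfl⟩
  have hPr := hrA r ⟨hr.le, le_rfl⟩
  exact ⟨hPr.1, hPr.2.1, fun s hs => (hrA s hs).2.2⟩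

/-- Every direction at the image of an interior point of an edge is the image of a direction at
that point. -/
theorem IsUnitSpeed.exists_direction {f : G.Point → H.Point} (hf : IsUnitSpeed f)
    (hb : NoBacktracking f) {p : G.Point} (hp : p ∉ G.vert) {d' : H.Edge × Bool} {w : ℝ}
    (hw : w ∈ Ioo 0 (H.len d'.1)) (hpw : f p = H.path d' w) :
    ∃ d u ε, u ∈ Ioo 0 (G.len d.1) ∧ G.path d u = p ∧ 0 < ε ∧
      ∀ s ∈ Icc 0 ε, f (G.path d (u + s)) = H.path d' (w + s) := by
  obtain ⟨e, u, hu, rfl⟩ := exists_edgeInterior hp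
  have hu' : G.len e - u ∈ Ioo 0 (G.len e) := ⟨by linarith [hu.2], by linarith [hu.1]⟩
  obtain ⟨ε₁, d₁, w₁, hε₁, h1, hw₁, h1', g₁⟩ := hf (e, true) u hu.1.le hu.2
  obtain ⟨ε₂, d₂, w₂, hε₂, h2, hw₂, h2', g₂⟩ := hf (e, false) (G.len e - u) hu'.1.le hu'.2
  have g₁0 := g₁ 0 ⟨le_rfl, hε₁.le⟩
  have g₂0 := g₂ 0 ⟨le_rfl, hε₂.le⟩
  rw [add_zero, add_zero, path_true, hpw] at g₁0
  rw [add_zero, add_zero, path_false, sub_sub_cancel, hpw] at g₂0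
  rcases path_eq_path hw ⟨hw₁, by linarith⟩ g₁0 with ⟨rfl, rfl⟩ | ⟨rfl, rfl⟩
  · exact ⟨_, _, ε₁, hu, path_true e u, hε₁, g₁⟩
  rcases path_eq_path hw ⟨hw₂, by linarith⟩ g₂0 with ⟨rfl, rfl⟩ | ⟨rfl, rfl⟩
  · refine ⟨_, _, ε₂, hu', ?_, hε₂, g₂⟩
    rw [path_false, sub_sub_cancel]
  exfalso
  refine hb.not_reflect (d := (e, true)) hu (lt_min hε₁ hε₂) fun s hs => ?_
  rw [g₁ s ⟨hs.1.le, hs.2.le.trans (min_le_left _ _)⟩,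
    ← g₂ s ⟨hs.1.le, hs.2.le.trans (min_le_right _ _)⟩, path_false, path_true]
  congr 2
  ring

/-- Two lifts of the same path that avoid the vertices in the interior of the parameter interval
are equal if they agree at one interior parameter. -/
theorem NoBacktracking.eqOn_of_lift {f : G.Point → H.Point} (hb : NoBacktracking f) {r m : ℝ}
    {σ τ : ℝ → G.Point} (hσ : Continuous σ) (hτ : Continuous τ)
    (hf : ∀ s ∈ Icc 0 r, f (σ s) = f (τ s)) (hv : ∀ s ∈ Ioo 0 r, σ s ∉ G.vert)
    (hm : m ∈ Ioo 0 r) (h : σ m = τ m) : EqOn σ τ (Icc 0 r) := by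
  have hcl : IsClosed {s | σ s = τ s} := isClosed_eq hσ hτ
  have hpre : IsPreconnected (Ioo 0 r) := isPreconnected_Ioo
  have hIoo : Ioo 0 r ⊆ {s | σ s = τ s} := by
    have hop : IsOpen (Ioo 0 r ∩ {s | σ s = τ s}) := by
      rw [isOpen_iff_mem_nhds]
      rintro s ⟨hs, hst⟩
      obtain ⟨U, hU, hinj⟩ := hb _ (hv s hs)
      have h1 : σ ⁻¹' U ∈ 𝓝 s := hσ.continuousAt hU
      have h2 : τ ⁻¹' U ∈ 𝓝 s := hτ.continuousAt (by rw [← show σ s = τ s from hst]; exact hU)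
      filter_upwards [h1, h2, isOpen_Ioo.mem_nhds hs] with y hy1 hy2 hy
      exact ⟨hy, hinj hy1 hy2 (hf y (Ioo_subset_Icc_self hy))⟩
    intro s hs
    by_contra hne
    obtain ⟨z, hz, hz1, hz2⟩ := hpre _ _ hop hcl.isOpen_compl
      (fun y hy => by by_cases hy' : y ∈ {s | σ s = τ s}
                      · exact Or.inl ⟨hy, hy'⟩
                      · exact Or.inr hy') ⟨m, hm, hm, h⟩ ⟨s, hs, hne⟩
    exact hz2 hz1.2
  have := closure_minimal hIoo hcl
  rw [closure_Ioo (by linarith [hm.1, hm.2])] at this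
  exact this

/-- The preimage of a finite set under a fold is finite: a fold is at most two-to-one. -/
theorem IsFold.finite_preimage {f : G.Point → H.Point} (hf : IsFold G H f) {S : Set H.Point}
    (hS : S.Finite) : (f ⁻¹' S).Finite := by
  obtain ⟨-, ⟨d₁, d₂, L, -, -, hL₁, hL₂, -, hiff⟩, -⟩ := hf
  refine hS.preimage' fun b _ => ?_
  by_cases hne : (f ⁻¹' {b}).Nonempty
  · obtain ⟨x, rfl⟩ := hne
    have h1 := (finite_path_preimage d₁ (Set.finite_singleton x)).image (G.path d₂)
    have h2 := (finite_path_preimage d₂ (Set.finite_singleton x)).image (G.path d₁)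
    refine ((Set.finite_singleton x).union (h1.union h2)).subset ?_
    intro y hy
    rcases (hiff x y).1 (Eq.symm hy) with rfl | ⟨t, ht, ⟨h3, h4⟩ | ⟨h3, h4⟩⟩
    · exact Or.inl rfl
    · exact Or.inr (Or.inl ⟨t, ⟨⟨ht.1, ht.2.trans hL₁⟩, h3.symm⟩, h4.symm⟩)
    · exact Or.inr (Or.inr ⟨t, ⟨⟨ht.1, ht.2.trans hL₂⟩, h3.symm⟩, h4.symm⟩)
  · rw [Set.not_nonempty_iff_eq_empty] at hne
    rw [hne]
    exact Set.finite_empty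

theorem rev_ne {α : Type*} (d : α × Bool) : rev d ≠ d := by
  obtain ⟨e, b⟩ := d
  cases b <;> simp [rev]

theorem path_injOn_Ico (d : G.Edge × Bool) : InjOn (G.path d) (Ico 0 (G.len d.1)) := by
  have key : ∀ u ∈ Ico 0 (G.len d.1), ∀ v ∈ Ico 0 (G.len d.1), 0 < u →
      G.path d u = G.path d v → u = v := by
    intro u hu v hv h0 h
    rcases path_eq_path ⟨h0, hu.2⟩ (Ico_subset_Icc_self hv) h with h' | h'
    · exact h'.2.symm
    · exact absurd h'.1.symm (rev_ne d)
  intro u hu v hv h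
  rcases hu.1.eq_or_lt with rfl | h0
  · rcases hv.1.eq_or_lt with rfl | h0'
    · rfl
    · exact (key v hv 0 hu h0' h.symm).symm
  · exact key u hu v hv h0 h

/-- The image of an arc of an edge is an arc of a directed edge, if it meets no vertex in
between. -/
theorem IsUnitSpeed.exists_image_arc {f : G.Point → H.Point} (hf : IsUnitSpeed f)
    (hb : NoBacktracking f) (hc : Continuous f) {e : G.Edge} {u v : ℝ} (hu : 0 ≤ u) (huv : u < v)
    (hv : v ≤ G.len e) (h : ∀ w ∈ Ioo u v, f (G.chart e w) ∉ H.vert) :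
    ∃ d' w, 0 ≤ w ∧ w + (v - u) ≤ H.len d'.1 ∧
      ∀ s ∈ Icc 0 (v - u), f (G.chart e (u + s)) = H.path d' (w + s) := by
  obtain ⟨ε, d', w, hε, h1, hw, h2, g⟩ := hf (e, true) u hu (huv.trans_le hv)
  obtain ⟨-, h3, h4⟩ := hf.extend hb hc hu (huv.trans_le hv) hw (by linarith) hε g
    (r := v - u) (by linarith) (by
      intro s hs _ _ hs'
      have hs1 : u + s ∈ Ioo u v := ⟨by linarith [hs.1], by linarith [hs.2]⟩
      refine ⟨path_notMem_vert (e, true) ⟨hu.trans_lt hs1.1, hs1.2.trans_le hv⟩, ?_⟩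
      rw [← hs', path_true]
      exact h _ hs1)
  exact ⟨d', w, hw, h3, fun s hs => by rw [← h4 s hs, path_true]⟩

theorem exists_isGreatest_eq {Y : Type*} [TopologicalSpace Y] [T1Space Y] {ω : ℝ → Y}
    (hω : Continuous ω) : ∃ t, IsGreatest {t | t ∈ Icc (0 : ℝ) 1 ∧ ω t = ω 0} t := by
  have hcl : IsClosed (ω ⁻¹' {ω 0}) := isClosed_singleton.preimage hω
  exact (isCompact_Icc.inter_right hcl).exists_isGreatest ⟨0, ⟨le_rfl, zero_le_one⟩, rfl⟩

/-- Let `p` be the only point of `V` that is a vertex or the image of a vertex, and let `V` contain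
no loop at `p`.  Then a path over `V` whose ends lie over `p` is closed: between two different
points over `p` it would run through an arc of an edge, the image of which is a loop at `p`. -/
theorem IsUnitSpeed.eq_of_path_over {f : G.Point → H.Point} (hf : IsUnitSpeed f)
    (hb : NoBacktracking f) (hc : Continuous f) {V : Set H.Point} {p : H.Point}
    (hfin : (f ⁻¹' {p}).Finite) (hV : ∀ q ∈ G.vert, f q ∈ V → f q = p)
    (hV' : ∀ q ∈ H.vert, q ∈ V → q = p)
    (hloop : ∀ e, H.chart e 0 = p → H.chart e (H.len e) = p → H.chart e (H.len e / 2) ∉ V)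
    {ω : ℝ → G.Point} (hω : Continuous ω) (hωV : ∀ t ∈ Icc (0 : ℝ) 1, f (ω t) ∈ V)
    (h0 : f (ω 0) = p) (h1 : f (ω 1) = p) : ω 0 = ω 1 := by
  by_contra hne
  obtain ⟨t₀, ⟨ht₀, ht₀ω⟩, ht₀max⟩ := exists_isGreatest_eq hω
  have hBcl : IsClosed (ω ⁻¹' (f ⁻¹' {p} \ {ω 0})) := (hfin.subset sdiff_subset).isClosed.preimage hω
  obtain ⟨t₁, ⟨ht₁, ht₁p, ht₁ω⟩, ht₁min⟩ :=
    ((isCompact_Icc (a := t₀) (b := 1)).inter_right hBcl).exists_isLeast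
    ⟨1, ⟨ht₀.2, le_rfl⟩, h1, Ne.symm hne⟩
  have hlt : t₀ < t₁ := lt_of_le_of_ne ht₁.1 (fun h => ht₁ω (by rw [← h]; exact ht₀ω))
  have hmid : ∀ t ∈ Ioo t₀ t₁, f (ω t) ≠ p := by
    intro t ht htp
    have htI : t ∈ Icc t₀ 1 := ⟨ht.1.le, ht.2.le.trans ht₁.2⟩
    by_cases h : ω t = ω 0
    · exact absurd (ht₀max ⟨⟨ht₀.1.trans htI.1, htI.2⟩, h⟩) (not_le.2 ht.1)
    · exact absurd (ht₁min ⟨htI, htp, h⟩) (not_le.2 ht.2)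
  have hIV : ∀ t ∈ Ioo t₀ t₁, f (ω t) ∈ V := fun t ht =>
    hωV t ⟨ht₀.1.trans ht.1.le, ht.2.le.trans ht₁.2⟩
  have hvert : ∀ q ∈ ω '' Ioo t₀ t₁, q ∉ G.vert := by
    rintro _ ⟨t, ht, rfl⟩ hq
    exact hmid t ht (hV _ hq (hIV t ht))
  have hCpre : IsPreconnected (ω '' Ioo t₀ t₁) := isPreconnected_Ioo.image _ hω.continuousOn
  have hm : (t₀ + t₁) / 2 ∈ Ioo t₀ t₁ := ⟨by linarith, by linarith⟩
  obtain ⟨e, he⟩ := exists_edgeInterior (hvert _ ⟨_, hm, rfl⟩)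
  have hCe := subset_edgeInterior_of_isPreconnected hCpre hvert ⟨_, hm, rfl⟩ he
  have hcl : ∀ t ∈ Icc t₀ t₁, ω t ∈ closure (ω '' Ioo t₀ t₁) := by
    intro t ht
    rw [← closure_Ioo hlt.ne] at ht
    exact image_closure_subset_closure_image hω ⟨t, ht, rfl⟩
  have key : ∀ u v, 0 ≤ u → u < v → v ≤ G.len e → f (G.chart e u) = p → f (G.chart e v) = p →
      (∀ w ∈ Ioo u v, f (G.chart e w) ≠ p ∧ f (G.chart e w) ∈ V) → False := by
    intro u v hu huv hv hup hvp hw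
    obtain ⟨d', w, hw0, hwl, harc⟩ := hf.exists_image_arc hb hc hu huv hv
      fun w hw' hwv => (hw w hw').1 (hV' _ hwv (hw w hw').2)
    have e0 := harc 0 ⟨le_rfl, by linarith⟩
    have e1 := harc (v - u) ⟨by linarith, le_rfl⟩
    rw [add_zero, add_zero, hup] at e0
    rw [add_sub_cancel, hvp] at e1
    have hw00 : w = 0 := by
      by_contra hw00
      have hwI : w ∈ Ioo 0 (H.len d'.1) := ⟨lt_of_le_of_ne hw0 (Ne.symm hw00), by linarith⟩
      rcases path_eq_path hwI ⟨by linarith, hwl⟩ (e0.symm.trans e1) with h | h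
      · linarith [h.2]
      · exact rev_ne d' h.1.symm
    subst hw00
    rw [zero_add] at e1 hwl
    have hlen : v - u = H.len d'.1 := by
      by_contra hlen
      refine path_notMem_vert d' (u := v - u) ⟨by linarith, lt_of_le_of_ne hwl hlen⟩ ?_
      rw [← e1, e0]
      exact path_zero_mem d'
    have hhalf := (hw (u + (v - u) / 2) ⟨by linarith, by linarith⟩).2
    rw [harc _ ⟨by linarith, by linarith⟩, zero_add, hlen] at hhalf
    rw [hlen] at e1
    obtain ⟨e', b⟩ := d'
    cases b
    · rw [path_false] at e0 e1 hhalf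
      refine hloop e' (by simpa using e1.symm) (by simpa using e0.symm) ?_
      convert hhalf using 2
      ring
    · rw [path_true] at e0 e1 hhalf
      exact hloop e' e0.symm e1.symm hhalf
  obtain ⟨u, hu, v, hv, huω, hvω, harc⟩ := exists_arc_of_isPreconnected hCpre hCe
    (hcl t₀ ⟨le_rfl, hlt.le⟩) (hcl t₁ ⟨hlt.le, le_rfl⟩)
  have hup : f (G.chart e u) = p := by rw [huω, ht₀ω, h0]
  have hvp : f (G.chart e v) = p := by rw [hvω]; exact ht₁p
  have harc' : ∀ w, (w ∈ Ioo u v ∨ w ∈ Ioo v u) → f (G.chart e w) ≠ p ∧ f (G.chart e w) ∈ V := by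
    intro w hw
    obtain ⟨t, ht, htw⟩ := (harc w hw).2
    rw [← htw]
    exact ⟨hmid t ht, hIV t ht⟩
  rcases lt_trichotomy u v with h | h | h
  · exact key u v hu.1 h hv.2 hup hvp fun w hw => harc' w (Or.inl hw)
  · apply ht₁ω
    rw [mem_singleton_iff, ← ht₀ω, ← huω, h, hvω]
  · exact key v u hv.1 h hu.2 hvp hup fun w hw => harc' w (Or.inr hw)

/-- A path that avoids the vertices, over the interior of an edge, is closed if its image is. -/
theorem IsUnitSpeed.eq_of_path_avoiding_vert {f : G.Point → H.Point} (hf : IsUnitSpeed f)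
    (hb : NoBacktracking f) (hc : Continuous f) {E : H.Edge} {ω : ℝ → G.Point}
    (hω : Continuous ω) (hE : ∀ t ∈ Icc (0 : ℝ) 1, f (ω t) ∈ H.edgeInterior E)
    (hv : ∀ t ∈ Icc (0 : ℝ) 1, ω t ∉ G.vert) (h01 : f (ω 0) = f (ω 1)) : ω 0 = ω 1 := by
  have hvert : ∀ q ∈ ω '' Icc 0 1, q ∉ G.vert := by
    rintro _ ⟨t, ht, rfl⟩
    exact hv t ht
  have hCpre : IsPreconnected (ω '' Icc 0 1) := isPreconnected_Icc.image _ hω.continuousOn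
  have hm0 : (0 : ℝ) ∈ Icc (0 : ℝ) 1 := ⟨le_rfl, zero_le_one⟩
  have hm1 : (1 : ℝ) ∈ Icc (0 : ℝ) 1 := ⟨zero_le_one, le_rfl⟩
  obtain ⟨e, he⟩ := exists_edgeInterior (hvert _ ⟨_, hm0, rfl⟩)
  have hCe := subset_edgeInterior_of_isPreconnected hCpre hvert ⟨_, hm0, rfl⟩ he
  have key : ∀ u v, 0 ≤ u → u < v → v ≤ G.len e → f (G.chart e u) = f (G.chart e v) →
      f (G.chart e u) ∉ H.vert → (∀ w ∈ Ioo u v, f (G.chart e w) ∉ H.vert) → False := by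
    intro u v hu huv hv hfe hup hw
    obtain ⟨d', w, hw0, hwl, harc⟩ := hf.exists_image_arc hb hc hu huv hv hw
    have e0 := harc 0 ⟨le_rfl, by linarith⟩
    have e1 := harc (v - u) ⟨by linarith, le_rfl⟩
    rw [add_zero, add_zero] at e0
    rw [add_sub_cancel, ← hfe] at e1
    have hwI := mem_Ioo_of_path_notMem_vert ⟨hw0, by linarith⟩ (e0 ▸ hup)
    rcases path_eq_path hwI ⟨by linarith, hwl⟩ (e0.symm.trans e1) with h | h
    · linarith [h.2]
    · exact rev_ne d' h.1.symm
  obtain ⟨u, hu, v, hv', huω, hvω, harc⟩ := exists_arc_of_isPreconnected hCpre hCe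
    (subset_closure ⟨0, hm0, rfl⟩) (subset_closure ⟨1, hm1, rfl⟩)
  have harc' : ∀ w, (w ∈ Ioo u v ∨ w ∈ Ioo v u) → f (G.chart e w) ∉ H.vert := by
    intro w hw
    obtain ⟨t, ht, htw⟩ := (harc w hw).2
    rw [← htw]
    exact edgeInterior_disjoint_vert (hE t ht)
  rcases lt_trichotomy u v with h | h | h
  · exact (key u v hu.1 h hv'.2 (by rw [huω, hvω, h01])
      (by rw [huω]; exact edgeInterior_disjoint_vert (hE 0 hm0))
      fun w hw => harc' w (Or.inl hw)).elim
  · rw [← huω, ← hvω, h]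
  · exact (key v u hv'.1 h hu.2 (by rw [huω, hvω, h01])
      (by rw [hvω]; exact edgeInterior_disjoint_vert (hE 1 hm1))
      fun w hw => harc' w (Or.inr hw)).elim

end MetricGraph

namespace GraphSequence

open MetricGraph

variable {ζ : GraphSequence}

/-! ### The levels of a split sequence -/

theorem comp_comp {i j k : ℕ} (h : i ≤ j) (h' : j ≤ k) (x : (ζ.G k).Point) :
    ζ.comp h (ζ.comp h' x) = ζ.comp (h.trans h') x := by
  induction k, h' using Nat.le_induction with
  | base => rw [comp_self]; rfl
  | succ k hk ih => rw [comp_succ ζ hk, ih, ← comp_succ ζ (h.trans hk)]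

theorem f_comp {j k : ℕ} (h : j + 1 ≤ k) (x : (ζ.G k).Point) :
    ζ.f j (ζ.comp h x) = ζ.comp (Nat.le_of_succ_le h) x := by
  rw [← comp_comp (Nat.le_succ j) h, comp_succ ζ le_rfl, comp_self]
  rfl

theorem comp_proj {j k : ℕ} (h : j ≤ k) (x : ζ.X) : ζ.comp h (ζ.proj k x) = ζ.proj j x := by
  induction k, h using Nat.le_induction with
  | base => rw [comp_self]; rfl
  | succ k hk ih =>
    rw [comp_succ ζ hk, ← ih]
    exact congrArg _ (x.2 k)

theorem continuous_proj (j : ℕ) : Continuous (ζ.proj j) :=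
  (continuous_apply j).comp continuous_subtype_val

theorem X_ext {x y : ζ.X} (h : ∀ j, ζ.proj j x = ζ.proj j y) : x = y :=
  Subtype.ext (funext h)

theorem proj_ne_of_le {x y : ζ.X} {j k : ℕ} (h : j ≤ k) (hne : ζ.proj j x ≠ ζ.proj j y) :
    ζ.proj k x ≠ ζ.proj k y := by
  intro hk
  apply hne
  rw [← comp_proj h, ← comp_proj h, hk]

theorem IsSplitSequence.continuous_comp {n : ℕ} (hs : ζ.IsSplitSequence n) {j k : ℕ} (h : j ≤ k) :
    Continuous (ζ.comp h) := by
  induction k, h using Nat.le_induction with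
  | base => rw [comp_self]; exact continuous_id
  | succ k hk ih =>
    rw [show ζ.comp (Nat.le_succ_of_le hk) = fun x => ζ.comp hk (ζ.f k x) from
      funext (comp_succ ζ hk)]
    exact ih.comp (hs.fold k).1.continuous

theorem IsSplitSequence.isUnitSpeed_comp {n : ℕ} (hs : ζ.IsSplitSequence n) {j k : ℕ}
    (h : j ≤ k) : IsUnitSpeed (ζ.comp h) := by
  induction k, h using Nat.le_induction with
  | base => rw [comp_self]; exact IsUnitSpeed.id
  | succ k hk ih =>
    rw [show ζ.comp (Nat.le_succ_of_le hk) = fun x => ζ.comp hk (ζ.f k x) from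
      funext (comp_succ ζ hk)]
    exact ih.comp (hs.fold k).2.2

theorem IsSplitSequence.noBacktracking_comp {n : ℕ} (hs : ζ.IsSplitSequence n) {j k : ℕ}
    (h : j ≤ k) : NoBacktracking (ζ.comp h) := by
  intro x hx
  obtain ⟨U, hU, hinj⟩ := hs.noBacktracking k x hx
  refine ⟨U, hU, fun a ha b hb hab => hinj ha hb ?_⟩
  rw [← comp_comp (Nat.zero_le j) h, hab, comp_comp]

theorem IsSplitSequence.finite_comp_preimage {n : ℕ} (hs : ζ.IsSplitSequence n) {j k : ℕ}
    (h : j ≤ k) {S : Set (ζ.G j).Point} (hS : S.Finite) : (ζ.comp h ⁻¹' S).Finite := by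
  induction k, h using Nat.le_induction with
  | base => rw [comp_self]; exact hS
  | succ k hk ih =>
    rw [show ζ.comp (Nat.le_succ_of_le hk) = fun x => ζ.comp hk (ζ.f k x) from
      funext (comp_succ ζ hk)]
    exact (hs.fold k).finite_preimage ih

/-- The point of the solenoid with given coordinates at the levels from `k` on. -/
def ofTail (k : ℕ) (p : ∀ i, (ζ.G (k + i)).Point) (hp : ∀ i, ζ.f (k + i) (p (i + 1)) = p i) :
    ζ.X :=
  ⟨fun j => ζ.comp (Nat.le_add_left j k) (p j), fun j => by
    rw [f_comp]
    refine Eq.trans ?_ (congrArg _ (hp j))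
    exact comp_succ ζ (Nat.le_add_left j k) _⟩

theorem proj_ofTail (k : ℕ) (p : ∀ i, (ζ.G (k + i)).Point)
    (hp : ∀ i, ζ.f (k + i) (p (i + 1)) = p i) (i : ℕ) : ζ.proj (k + i) (ofTail k p hp) = p i := by
  have key : ∀ i', ∀ h : i ≤ i', ζ.comp (Nat.add_le_add_left h k) (p i') = p i := by
    intro i' h
    induction i', h using Nat.le_induction with
    | base => rw [comp_self]; rfl
    | succ i' h ih =>
      rw [← ih, ← hp i']
      exact comp_succ ζ (Nat.add_le_add_left h k) _
  exact key (k + i) (Nat.le_add_left i k)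

/-- The points of `G_k` that lie over an optimal point of `G_0`. -/
def overOptimal (ζ : GraphSequence) (k : ℕ) : Set (ζ.G k).Point :=
  {p | ζ.IsOptimalPoint 0 (ζ.comp (Nat.zero_le k) p)}

theorem mem_overOptimal_of_isSpecial {k : ℕ} {p : (ζ.G k).Point} (h : ζ.IsSpecial k p) :
    p ∈ ζ.overOptimal k := by
  refine Or.inl (Or.inr ?_)
  rcases h with ⟨j, hj, h⟩ | ⟨j, hj, v, hv, rfl⟩
  · exact ⟨j, Nat.zero_le j, _, h, comp_comp _ _ _⟩
  · exact ⟨j, Nat.zero_le j, v, hv, (comp_comp _ _ _).symm⟩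

theorem isSpecial_of_mem_vert {k : ℕ} {p : (ζ.G k).Point} (h : p ∈ (ζ.G k).vert) :
    ζ.IsSpecial k p :=
  Or.inl ⟨k, le_rfl, by rw [comp_self]; exact h⟩

theorem mem_overOptimal_of_mem_vert {k : ℕ} {p : (ζ.G k).Point} (h : p ∈ (ζ.G k).vert) :
    p ∈ ζ.overOptimal k :=
  mem_overOptimal_of_isSpecial (isSpecial_of_mem_vert h)

theorem comp_mem_overOptimal {j k : ℕ} (h : j ≤ k) {p : (ζ.G k).Point} :
    ζ.comp h p ∈ ζ.overOptimal j ↔ p ∈ ζ.overOptimal k := by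
  unfold overOptimal
  rw [mem_ofPred_eq, mem_ofPred_eq, comp_comp]

theorem mem_overOptimal_zero {p : (ζ.G 0).Point} : p ∈ ζ.overOptimal 0 ↔ ζ.IsOptimalPoint 0 p := by
  unfold overOptimal
  rw [mem_ofPred_eq, comp_self]
  rfl

theorem IsProper.finite_overOptimal_zero (hp : ζ.IsProper) : (ζ.overOptimal 0).Finite := by
  have hmid : (range fun e : (ζ.G 0).Edge => (ζ.G 0).chart e ((ζ.G 0).len e / 2)).Finite :=
    Set.finite_range _
  refine (((ζ.G 0).vert_finite.union hp).union hmid).subset fun p h => ?_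
  rw [mem_overOptimal_zero] at h
  rcases h with (⟨j, hj, h⟩ | ⟨j, hj, v, hv, rfl⟩) | ⟨e, -, rfl⟩
  · obtain rfl : j = 0 := by omega
    rw [comp_self] at h
    exact Or.inl (Or.inl h)
  · rcases Nat.eq_zero_or_pos j with rfl | h0
    · refine Or.inl (Or.inl ?_)
      rw [comp_self]
      exact hv
    · exact Or.inl (Or.inr ⟨j, h0, v, hv, rfl⟩)
  · exact Or.inr ⟨e, rfl⟩

theorem IsSplitSequence.finite_overOptimal {n : ℕ} (hs : ζ.IsSplitSequence n) (hp : ζ.IsProper)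
    (k : ℕ) : (ζ.overOptimal k).Finite := by
  refine (hs.finite_comp_preimage (Nat.zero_le k) hp.finite_overOptimal_zero).subset ?_
  intro p h
  exact (comp_mem_overOptimal _).2 h

/-! ### Lifting arcs to the solenoid -/

open CategoryTheory in
/-- An arc of a directed edge of `G_k` without optimal points in its interior lifts to the solenoid
if it lifts to infinitely many deeper levels with given compatible initial points.  At each level
there are finitely many lifts, so Kőnig's lemma applies. -/
theorem IsSplitSequence.exists_lift_of_frequently {n : ℕ} (hs : ζ.IsSplitSequence n) {k : ℕ}
    (x : ζ.X) {d : (ζ.G k).Edge × Bool} {w r : ℝ} (hr : 0 < r)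
    (hopt : ∀ s ∈ Ioo 0 r, (ζ.G k).path d (w + s) ∉ ζ.overOptimal k)
    (hx : ∀ i₀, ∃ i ≥ i₀, ∃ σ : ℝ → (ζ.G (k + i)).Point, ContinuousOn σ (Icc 0 r) ∧
      (∀ s ∈ Icc 0 r, ζ.comp (Nat.le_add_right k i) (σ s) = (ζ.G k).path d (w + s)) ∧
      σ 0 = ζ.proj (k + i) x) :
    ∃ γ : ℝ → ζ.X, Continuous γ ∧ (∀ s ∈ Icc 0 r, ζ.proj k (γ s) = (ζ.G k).path d (w + s)) ∧
      γ 0 = x := by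
  let z : Icc (0 : ℝ) r := ⟨0, le_rfl, hr.le⟩
  let S : ℕ → Type _ := fun i => {σ : Icc (0 : ℝ) r → (ζ.G (k + i)).Point // Continuous σ ∧
    (∀ s, ζ.comp (Nat.le_add_right k i) (σ s) = (ζ.G k).path d (w + s)) ∧
    σ z = ζ.proj (k + i) x}
  let φ : ∀ i, S (i + 1) → S i := fun i σ => ⟨fun s => ζ.f (k + i) (σ.1 s),
    (hs.fold (k + i)).1.continuous.comp σ.2.1,
    fun s => by rw [← σ.2.2.1 s]; exact (comp_succ ζ (Nat.le_add_right k i) _).symm,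
    (congrArg _ σ.2.2.2).trans (x.2 (k + i))⟩
  have hne : ∀ i, Nonempty (S i) := by
    have hdown : ∀ i i', i ≤ i' → Nonempty (S i') → Nonempty (S i) := by
      intro i i' h
      induction i', h using Nat.le_induction with
      | base => exact id
      | succ i' h ih => exact fun ⟨σ⟩ => ih ⟨φ i' σ⟩
    intro i
    obtain ⟨i', hi', σ, hσ, hσl, hσ0⟩ := hx i
    exact hdown i i' hi' ⟨⟨fun s => σ s, hσ.comp_continuous continuous_subtype_val fun s => s.2,
      fun s => hσl s s.2, hσ0⟩⟩
  have hm : r / 2 ∈ Ioo 0 r := ⟨by linarith, by linarith⟩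
  have hfin : ∀ i, Finite (S i) := by
    intro i
    let m : Icc (0 : ℝ) r := ⟨r / 2, Ioo_subset_Icc_self hm⟩
    have hF : (ζ.comp (Nat.le_add_right k i) ⁻¹' {(ζ.G k).path d (w + r / 2)}).Finite :=
      hs.finite_comp_preimage _ (Set.finite_singleton _)
    have := hF.to_subtype
    refine Finite.of_injective (β := ↥(ζ.comp (Nat.le_add_right k i) ⁻¹'
      {(ζ.G k).path d (w + r / 2)})) (fun σ => ⟨σ.1 m, σ.2.2.1 m⟩) ?_
    intro σ τ h
    have hmm : σ.1 m = τ.1 m := congrArg Subtype.val h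
    have heq := (hs.noBacktracking_comp (Nat.le_add_right k i)).eqOn_of_lift (r := r) (m := r / 2)
      (σ := fun s => σ.1 (projIcc 0 r hr.le s)) (τ := fun s => τ.1 (projIcc 0 r hr.le s))
      (σ.2.1.comp continuous_projIcc) (τ.2.1.comp continuous_projIcc)
      (fun s _ => by rw [σ.2.2.1, τ.2.2.1]) (fun s hs' hv => by
        refine hopt s hs' ?_
        have h1 := σ.2.2.1 (projIcc 0 r hr.le s)
        rw [projIcc_of_mem hr.le (Ioo_subset_Icc_self hs')] at h1 hv
        rw [← h1, comp_mem_overOptimal]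
        exact mem_overOptimal_of_mem_vert hv) hm (by
        rw [projIcc_of_mem hr.le (Ioo_subset_Icc_self hm)]
        exact hmm)
    refine Subtype.ext (funext fun s => ?_)
    have := heq s.2
    simp only [projIcc_val] at this
    exact this
  let F := CategoryTheory.Functor.ofOpSequence (X := S) (fun i => ↾(φ i))
  have h1 : ∀ j, Finite (F.obj j) := fun j => hfin j.unop
  have h2 : ∀ j, Nonempty (F.obj j) := fun j => hne j.unop
  obtain ⟨σ, hσ⟩ := nonempty_sections_of_finite_inverse_system F
  have hcompat : ∀ i, φ i (σ ⟨i + 1⟩) = σ ⟨i⟩ := by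
    intro i
    have := hσ (CategoryTheory.homOfLE (Nat.le_add_right i 1)).op
    rw [CategoryTheory.Functor.ofOpSequence_map_homOfLE_succ] at this
    exact this
  let τ : ∀ i, S i := fun i => σ ⟨i⟩
  have hτ : ∀ i, φ i (τ (i + 1)) = τ i := hcompat
  have hτ' : ∀ s i, ζ.f (k + i) ((τ (i + 1)).1 s) = (τ i).1 s := fun s i => by
    rw [← hτ i]
  let γ : Icc (0 : ℝ) r → ζ.X := fun s => ofTail k (fun i => (τ i).1 s) (hτ' s)
  have hγ : Continuous γ := by
    refine Continuous.subtype_mk (continuous_pi fun j => ?_) _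
    exact (hs.continuous_comp _).comp (τ j).2.1
  refine ⟨fun s => γ (projIcc 0 r hr.le s), hγ.comp continuous_projIcc, fun s hs' => ?_, ?_⟩
  · have h3 := proj_ofTail k (fun i => (τ i).1 (projIcc 0 r hr.le s)) (hτ' _) 0
    have h4 := (τ 0).2.2.1 (projIcc 0 r hr.le s)
    rw [projIcc_of_mem hr.le hs'] at h3
    have h5 : γ (projIcc 0 r hr.le s) = γ ⟨s, hs'⟩ := by rw [projIcc_of_mem hr.le hs']
    simp only [h5]
    rw [projIcc_of_mem hr.le hs'] at h4
    rw [← h4]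
    refine Eq.trans h3 ?_
    exact (congrFun (comp_self ζ k) _).symm
  · have hz : projIcc 0 r hr.le 0 = z := projIcc_left hr.le
    simp only [hz]
    refine X_ext fun j => ?_
    rw [← comp_proj (Nat.le_add_left j k), ← comp_proj (Nat.le_add_left j k)]
    congr 1
    rw [proj_ofTail]
    exact (τ j).2.2.2

/-- A direction at level `k + i` over a direction at level `k` gives lifts at level `k + i`. -/
theorem IsSplitSequence.exists_level_lift {n : ℕ} (hs : ζ.IsSplitSequence n) {k i : ℕ}
    {d : (ζ.G k).Edge × Bool} {d' : (ζ.G (k + i)).Edge × Bool} {w u r ε : ℝ} (hr : 0 < r)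
    (hw : 0 ≤ w) (hwr : w + r ≤ (ζ.G k).len d.1)
    (hopt : ∀ s ∈ Ioo 0 r, (ζ.G k).path d (w + s) ∉ ζ.overOptimal k)
    (hu : 0 ≤ u) (hul : u < (ζ.G (k + i)).len d'.1) (hε : 0 < ε)
    (germ : ∀ s ∈ Icc 0 ε, ζ.comp (Nat.le_add_right k i) ((ζ.G (k + i)).path d' (u + s)) =
      (ζ.G k).path d (w + s)) :
    ∃ σ : ℝ → (ζ.G (k + i)).Point, ContinuousOn σ (Icc 0 r) ∧
      (∀ s ∈ Icc 0 r, ζ.comp (Nat.le_add_right k i) (σ s) = (ζ.G k).path d (w + s)) ∧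
      σ 0 = (ζ.G (k + i)).path d' u := by
  obtain ⟨h1, -, h3⟩ := (hs.isUnitSpeed_comp (Nat.le_add_right k i)).extend
    (hs.noBacktracking_comp _) (hs.continuous_comp _) hu hul hw (by linarith) hε germ hr (by
      intro s hs' _ _ heq
      refine ⟨fun hv => hopt s hs' ?_, fun hv => hopt s hs' (mem_overOptimal_of_mem_vert hv)⟩
      rw [← heq, comp_mem_overOptimal]
      exact mem_overOptimal_of_mem_vert hv)
  refine ⟨fun s => (ζ.G (k + i)).path d' (u + s), ?_, h3, by simp⟩
  exact (path_continuousOn d').comp (by fun_prop) fun s hs' =>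
    ⟨by linarith [hs'.1], by linarith [hs'.2]⟩

/-- An arc of an open edge, without optimal points in its interior, lifts to the solenoid with any
given initial point: since this is not a pre-singularity, at infinitely many levels it is no vertex,
and there the direction lifts. -/
theorem IsSplitSequence.exists_lift {n : ℕ} (hs : ζ.IsSplitSequence n) (hst : ζ.IsStabilized)
    {k : ℕ} (x : ζ.X) {d : (ζ.G k).Edge × Bool} {w r : ℝ} (hr : 0 < r)
    (hw : 0 < w) (hwr : w + r ≤ (ζ.G k).len d.1)
    (hopt : ∀ s ∈ Ioo 0 r, (ζ.G k).path d (w + s) ∉ ζ.overOptimal k)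
    (hx : ζ.proj k x = (ζ.G k).path d w) :
    ∃ γ : ℝ → ζ.X, Continuous γ ∧ (∀ s ∈ Icc 0 r, ζ.proj k (γ s) = (ζ.G k).path d (w + s)) ∧
      γ 0 = x := by
  have hwI : w ∈ Ioo 0 ((ζ.G k).len d.1) := ⟨hw, by linarith⟩
  refine hs.exists_lift_of_frequently x hr hopt fun i₀ => ?_
  have hpre : ¬ ζ.IsPreSingularity x := fun h =>
    hst.vertex_none k _ (path_notMem_vert d hwI) x h hx
  unfold IsPreSingularity at hpre
  push Not at hpre
  obtain ⟨j, hj, hjv⟩ := hpre (k + i₀)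
  obtain ⟨i, rfl⟩ := Nat.exists_eq_add_of_le (show k ≤ j by omega)
  obtain ⟨d', u, ε, hu, hup, hε, germ⟩ :=
    (hs.isUnitSpeed_comp (Nat.le_add_right k i)).exists_direction (hs.noBacktracking_comp _) hjv
      hwI (by rw [comp_proj, hx])
  refine ⟨i, by omega, ?_⟩
  rw [← hup]
  exact hs.exists_level_lift hr hw.le hwr hopt hu.1.le hu.2 hε germ

/-- At each point of the solenoid some direction of the level `k` graph lifts. -/
theorem IsSplitSequence.exists_lift_of_point {n : ℕ} (hs : ζ.IsSplitSequence n)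
    (k : ℕ) (x : ζ.X) :
    ∃ (d : (ζ.G k).Edge × Bool) (w : ℝ), 0 ≤ w ∧ w < (ζ.G k).len d.1 ∧
      (ζ.G k).path d w = ζ.proj k x ∧ ∀ r, 0 < r → w + r ≤ (ζ.G k).len d.1 →
      (∀ s ∈ Ioo 0 r, (ζ.G k).path d (w + s) ∉ ζ.overOptimal k) →
      ∃ γ : ℝ → ζ.X, Continuous γ ∧ (∀ s ∈ Icc 0 r, ζ.proj k (γ s) = (ζ.G k).path d (w + s)) ∧
        γ 0 = x := by
  have hgerm : ∀ i, ∃ (d : (ζ.G k).Edge × Bool) (w : ℝ) (d' : (ζ.G (k + i)).Edge × Bool) (u ε : ℝ),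
      0 ≤ w ∧ w < (ζ.G k).len d.1 ∧ 0 ≤ u ∧ u < (ζ.G (k + i)).len d'.1 ∧ 0 < ε ∧
      (ζ.G (k + i)).path d' u = ζ.proj (k + i) x ∧
      ∀ s ∈ Icc 0 ε, ζ.comp (Nat.le_add_right k i) ((ζ.G (k + i)).path d' (u + s)) =
        (ζ.G k).path d (w + s) := by
    intro i
    obtain ⟨d', u, hu, hul, hup⟩ := (hs.core (k + i)).exists_path (ζ.proj (k + i) x)
    obtain ⟨ε, d, w, hε, h1, hw, h2, g⟩ := hs.isUnitSpeed_comp (Nat.le_add_right k i) d' u hu hul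
    exact ⟨d, w, d', u, ε, hw, by linarith, hu, hul, hε, hup, g⟩
  choose D W D' U E hW hWl hU hUl hE hP hg using hgerm
  obtain ⟨d, hd⟩ := Finite.exists_infinite_fiber D
  have hDW : ∀ i, (ζ.G k).path (D i) (W i) = ζ.proj k x := by
    intro i
    have := hg i 0 ⟨le_rfl, (hE i).le⟩
    rw [add_zero, add_zero, hP i, comp_proj] at this
    exact this.symm
  have hinf : (D ⁻¹' {d}).Infinite := infinite_coe_iff.1 hd
  obtain ⟨i₁, hi₁⟩ := hinf.nonempty
  obtain rfl : D i₁ = d := hi₁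
  refine ⟨D i₁, W i₁, hW _, hWl _, hDW _, fun r hr hwr hopt => ?_⟩
  refine hs.exists_lift_of_frequently x hr hopt fun i₀ => ?_
  obtain ⟨i, hiD, hi⟩ := hinf.exists_gt i₀
  have hiD' : D i = D i₁ := hiD
  have hWi : W i = W i₁ := by
    refine path_injOn_Ico (D i₁) ⟨hW i, ?_⟩ ⟨hW i₁, hWl i₁⟩ ?_
    · rw [← hiD']; exact hWl i
    · rw [hDW i₁, ← hiD', hDW i]
  refine ⟨i, hi.le, ?_⟩
  rw [← hP i]
  refine hs.exists_level_lift hr (hW i₁) hwr hopt (hU i) (hUl i) (hE i) ?_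
  have := hg i
  rwa [hiD', hWi] at this

end GraphSequence

/-! ### Star sets -/

theorem single_mem_star {n : ℕ} (i : Fin n) {t : ℝ} (ht : t ∈ Ico (0 : ℝ) 1) :
    (Pi.single i t : Fin n → ℝ) ∈ Star n :=
  ⟨i, t, ht, rfl⟩

theorem single_eq_single {n : ℕ} {i j : Fin n} {t s : ℝ}
    (h : (Pi.single i t : Fin n → ℝ) = Pi.single j s) : (i = j ∧ t = s) ∨ (t = 0 ∧ s = 0) := by
  by_cases hij : i = j
  · subst hij
    exact Or.inl ⟨rfl, Pi.single_injective i h⟩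
  · right
    have h1 := congrFun h i
    have h2 := congrFun h j
    rw [Pi.single_eq_same, Pi.single_eq_of_ne hij] at h1
    rw [Pi.single_eq_same, Pi.single_eq_of_ne (Ne.symm hij)] at h2
    exact ⟨h1, h2.symm⟩

theorem continuous_single {n : ℕ} (i : Fin n) :
    Continuous (fun t : ℝ => (Pi.single i t : Fin n → ℝ)) :=
  (continuous_const (y := (0 : Fin n → ℝ))).update i continuous_id

/-- A star with more than two prongs does not embed in the line: two of its prongs would leave the
image of the center on the same side. -/
theorem not_injective_star {n : ℕ} (hn : 2 < n) {F : Star n → ℝ} (hF : Continuous F)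
    (hinj : Function.Injective F) : False := by
  let i : Fin 3 → Fin n := fun k => ⟨k, by omega⟩
  have hi : Function.Injective i := fun a b h => by
    have := congrArg Fin.val h
    exact Fin.ext this
  have h0 : (0 : ℝ) ∈ Ico (0 : ℝ) 1 := ⟨le_rfl, zero_lt_one⟩
  have hsub : Icc (0 : ℝ) (1 / 2) ⊆ Ico 0 1 := fun t ht => ⟨ht.1, by linarith [ht.2]⟩
  let pt : Fin 3 → Ico (0 : ℝ) 1 → Star n := fun k t => ⟨Pi.single (i k) t, single_mem_star _ t.2⟩
  have hpt : ∀ k, Continuous (pt k) := fun k =>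
    ((Solenoids.continuous_single (i k)).comp continuous_subtype_val).subtype_mk _
  let hh : Ico (0 : ℝ) 1 := ⟨1 / 2, by norm_num, by norm_num⟩
  have hzero : ∀ k l, pt k ⟨0, h0⟩ = pt l ⟨0, h0⟩ := fun k l => Subtype.ext (by simp [pt])
  have key : ∀ g : Star n → ℝ, Continuous g → Function.Injective g → ∀ k l, k ≠ l →
      g (pt 0 ⟨0, h0⟩) < g (pt k hh) → g (pt 0 ⟨0, h0⟩) < g (pt l hh) → False := by
    intro g hg hginj k l hkl hk hl
    set m := min (g (pt k hh)) (g (pt l hh)) with hm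
    have hm0 : g (pt 0 ⟨0, h0⟩) < m := lt_min hk hl
    have hivt : ∀ q, m ≤ g (pt q hh) → ∃ t : Ico (0 : ℝ) 1, g (pt q t) = m := by
      intro q hq
      have hc : Continuous fun t => g (pt q t) := hg.comp (hpt q)
      have hpre : PreconnectedSpace (Ico (0 : ℝ) 1) :=
        isPreconnected_iff_preconnectedSpace.1 isPreconnected_Ico
      have := isPreconnected_univ.intermediate_value (mem_univ (⟨0, h0⟩ : Ico (0 : ℝ) 1))
        (mem_univ hh) hc.continuousOn (show m ∈ Icc _ _ from
          ⟨by rw [hzero q 0]; exact hm0.le, hq⟩)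
      obtain ⟨t, -, ht⟩ := this
      exact ⟨t, ht⟩
    obtain ⟨t, ht⟩ := hivt k (min_le_left _ _)
    obtain ⟨s, hs⟩ := hivt l (min_le_right _ _)
    have heq := congrArg Subtype.val (hginj (ht.trans hs.symm))
    rcases single_eq_single heq with ⟨h1, -⟩ | ⟨h1, -⟩
    · exact hkl (hi h1)
    · have : t = ⟨0, h0⟩ := Subtype.ext h1
      rw [this, hzero k 0] at ht
      exact hm0.ne ht
  have hne : ∀ k, F (pt k hh) ≠ F (pt 0 ⟨0, h0⟩) := by
    intro k h
    have heq := congrArg Subtype.val (hinj h)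
    rcases single_eq_single heq with ⟨-, h1⟩ | ⟨h1, -⟩ <;> norm_num [hh] at h1
  have hneg : ∀ k l, k ≠ l → F (pt k hh) < F (pt 0 ⟨0, h0⟩) → F (pt l hh) < F (pt 0 ⟨0, h0⟩) →
      False := fun k l hkl hk hl =>
    key (fun x => - F x) hF.neg (fun a b h => hinj (neg_injective h)) k l hkl
      (neg_lt_neg hk) (neg_lt_neg hl)
  have hpos := key F hF hinj
  rcases (hne 0).lt_or_gt with a | a <;> rcases (hne 1).lt_or_gt with b | b <;>
    rcases (hne 2).lt_or_gt with c | c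
  · exact hneg 0 1 (by decide) a b
  · exact hneg 0 1 (by decide) a b
  · exact hneg 0 2 (by decide) a c
  · exact hpos 1 2 (by decide) b c
  · exact hneg 1 2 (by decide) b c
  · exact hpos 0 2 (by decide) a c
  · exact hpos 0 1 (by decide) a b
  · exact hpos 0 1 (by decide) a b

theorem IsStarSet.center_mem {Y : Type*} [TopologicalSpace Y] {n : ℕ} {S : Set Y} {c : Y}
    (h : IsStarSet n S c) : c ∈ S := by
  obtain ⟨hn, h, hc⟩ := h
  have h0 : (0 : Fin n → ℝ) ∈ Star n :=
    ⟨⟨0, by omega⟩, 0, ⟨le_rfl, zero_lt_one⟩, by simp⟩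
  rw [← hc ⟨0, h0⟩ rfl]
  exact (h _).2

theorem IsStarSet.isPreconnected {Y : Type*} [TopologicalSpace Y] {n : ℕ} {S : Set Y} {c : Y}
    (hS : IsStarSet n S c) : IsPreconnected S := by
  obtain ⟨hn, h, hc⟩ := hS
  refine isPreconnected_of_forall c fun y hy => ?_
  obtain ⟨x, hx⟩ := h.surjective ⟨y, hy⟩
  obtain ⟨i, t, ht, hxi⟩ := x.2
  let pt : Ico (0 : ℝ) 1 → Star n := fun t => ⟨Pi.single i t, single_mem_star _ t.2⟩
  have hpt : Continuous fun t => ((h (pt t) : S) : Y) :=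
    continuous_subtype_val.comp (h.continuous.comp
      (((Solenoids.continuous_single i).comp continuous_subtype_val).subtype_mk _))
  have hpre : PreconnectedSpace (Ico (0 : ℝ) 1) :=
    isPreconnected_iff_preconnectedSpace.1 isPreconnected_Ico
  refine ⟨range fun t => ((h (pt t) : S) : Y), ?_, ?_, ?_, isPreconnected_range hpt⟩
  · rintro _ ⟨t, rfl⟩
    exact (h _).2
  · exact ⟨⟨0, le_rfl, zero_lt_one⟩, hc _ (by simp [pt])⟩
  · refine ⟨⟨t, ht⟩, ?_⟩
    have : pt ⟨t, ht⟩ = x := Subtype.ext hxi.symm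
    simp only [this, hx]

theorem isStarSet_range {Y : Type*} [TopologicalSpace Y] {n : ℕ} (hn : 2 ≤ n) {h : Star n → Y}
    (hh : IsEmbedding h) {c : Y} (hc : ∀ x : Star n, (x : Fin n → ℝ) = 0 → h x = c) :
    IsStarSet n (range h) c :=
  ⟨hn, hh.toHomeomorph, hc⟩

/-- The two-pronged star, as an interval. -/
theorem exists_homeomorph_star_two {Y : Type*} [TopologicalSpace Y] {j : ℝ → Y} {g : Y → ℝ}
    {c η : ℝ} (hη : 0 < η) (hj : ContinuousOn j (Ioo (c - η) (c + η)))
    (hg : ContinuousOn g (j '' Ioo (c - η) (c + η)))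
    (hgj : ∀ t ∈ Ioo (c - η) (c + η), g (j t) = t) :
    ∃ h : Star 2 ≃ₜ j '' Ioo (c - η) (c + η),
      ∀ x : Star 2, (x : Fin 2 → ℝ) = 0 → (h x : Y) = j c := by
  have hmem : ∀ x : Star 2, c + η * (x.1 0 - x.1 1) ∈ Ioo (c - η) (c + η) := by
    rintro ⟨x, i, t, ht, rfl⟩
    have h1 : η * t < η := by nlinarith [ht.2]
    have h2 : 0 ≤ η * t := mul_nonneg hη.le ht.1
    fin_cases i <;> simp <;> constructor <;> linarith
  let v : ℝ → Fin 2 → ℝ := fun s => ![max s 0, max (-s) 0]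
  have hvpos : ∀ s, 0 ≤ s → v s = Pi.single 0 s := by
    intro s hs
    ext k
    fin_cases k <;> simp [v, hs]
  have hvneg : ∀ s, s ≤ 0 → v s = Pi.single 1 (-s) := by
    intro s hs
    ext k
    fin_cases k <;> simp [v, hs]
  have hv : ∀ t ∈ Ioo (c - η) (c + η), v ((t - c) / η) ∈ Star 2 := by
    intro t ht
    have h1 : (t - c) / η < 1 := by rw [div_lt_one hη]; linarith [ht.2]
    have h2 : -1 < (t - c) / η := by rw [lt_div_iff₀ hη]; linarith [ht.1]
    rcases le_total 0 ((t - c) / η) with h | h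
    · rw [hvpos _ h]
      exact single_mem_star _ ⟨h, h1⟩
    · rw [hvneg _ h]
      exact single_mem_star _ ⟨by linarith, by linarith⟩
  have hvc : Continuous v := by
    refine continuous_pi fun k => ?_
    fin_cases k <;> simp [v] <;> fun_prop
  have hgmem : ∀ y : j '' Ioo (c - η) (c + η), g y ∈ Ioo (c - η) (c + η) := by
    rintro ⟨_, t, ht, rfl⟩
    rw [hgj t ht]
    exact ht
  refine ⟨{ toFun := fun x => ⟨j (c + η * (x.1 0 - x.1 1)), _, hmem x, rfl⟩
            invFun := fun y => ⟨v ((g y - c) / η), hv _ (hgmem y)⟩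
            left_inv := ?_
            right_inv := ?_
            continuous_toFun := ?_
            continuous_invFun := ?_ }, ?_⟩
  · intro x
    refine Subtype.ext ?_
    simp only
    rw [hgj _ (hmem x), add_sub_cancel_left, mul_div_cancel_left₀ _ hη.ne']
    obtain ⟨x, i, t, ht, rfl⟩ := x
    fin_cases i
    · simp [hvpos t ht.1]
    · simp [hvneg (-t) (by linarith [ht.1])]
  · rintro ⟨_, t, ht, rfl⟩
    refine Subtype.ext ?_
    simp only
    rw [hgj t ht]
    congr 1
    have : v ((t - c) / η) 0 - v ((t - c) / η) 1 = (t - c) / η := by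
      simp only [v, Matrix.cons_val_zero, Matrix.cons_val_one]
      rcases le_total 0 ((t - c) / η) with h | h
      · rw [max_eq_left h, max_eq_right (by linarith)]; ring
      · rw [max_eq_right h, max_eq_left (by linarith)]; ring
    rw [this]
    field_simp
    ring
  · refine Continuous.subtype_mk (hj.comp_continuous ?_ hmem) _
    have h1 : ∀ i, Continuous fun x : Star 2 => x.1 i := fun i =>
      (continuous_apply i).comp continuous_subtype_val
    exact continuous_const.add (continuous_const.mul ((h1 0).sub (h1 1)))
  · refine Continuous.subtype_mk (hvc.comp ?_) _
    have : Continuous fun y : j '' Ioo (c - η) (c + η) => g y := hg.domRestrict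
    exact (this.sub continuous_const).div_const _
  · intro x hx
    have : c + η * (x.1 0 - x.1 1) = c := by rw [hx]; simp
    show j (c + η * (x.1 0 - x.1 1)) = j c
    rw [this]

theorem starTurn_two : starTurn 2 0 1 = univ := by
  refine eq_univ_of_forall ?_
  rintro ⟨x, i, t, ht, rfl⟩
  refine ⟨t, ht, ?_⟩
  fin_cases i <;> simp

theorem isTurnOf_self {Y : Type*} [TopologicalSpace Y] {T : Set Y} (h : Star 2 ≃ₜ T) :
    IsTurnOf T T := by
  refine ⟨2, le_rfl, h, 0, 1, by decide, ?_⟩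
  rw [starTurn_two, image_univ]
  ext y
  constructor
  · intro hy
    obtain ⟨x, hx⟩ := h.surjective ⟨y, hy⟩
    exact ⟨x, by simp only [hx]⟩
  · rintro ⟨x, rfl⟩
    exact (h x).2

namespace MetricGraph

variable {G : MetricGraph}

theorem isStarSet_two_chart {e : G.Edge} {c η : ℝ} (hη : 0 < η) (h0 : 0 ≤ c - η)
    (h1 : c + η ≤ G.len e) :
    IsStarSet 2 (G.chart e '' Ioo (c - η) (c + η)) (G.chart e c) := by
  have hsub : Ioo (c - η) (c + η) ⊆ Ioo 0 (G.len e) := fun t ht =>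
    ⟨by linarith [ht.1], by linarith [ht.2]⟩
  obtain ⟨h, hh⟩ := exists_homeomorph_star_two (j := G.chart e) (g := G.coord e) hη
    ((G.chart_continuousOn e).mono (hsub.trans Ioo_subset_Icc_self))
    ((continuousOn_coord e).mono (image_mono hsub)) fun t ht => coord_chart (hsub ht)
  exact ⟨le_rfl, h, hh⟩

end MetricGraph

/-- The map from the model star that runs along the given prongs. -/
noncomputable def starMap {Y : Type*} {n : ℕ} (a : Fin n → ℝ → Y) (x : Star n) : Y :=
  a x.2.choose x.2.choose_spec.choose

theorem starMap_single {Y : Type*} {n : ℕ} {a : Fin n → ℝ → Y} {p : Y} (ha : ∀ i, a i 0 = p)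
    {x : Star n} {i : Fin n} {t : ℝ} (hx : (x : Fin n → ℝ) = Pi.single i t) :
    starMap a x = a i t := by
  have h := x.2.choose_spec.choose_spec.2
  unfold starMap
  rcases single_eq_single (h.symm.trans hx) with ⟨h1, h2⟩ | ⟨h1, h2⟩
  · rw [h2, h1]
  · rw [h1, h2, ha, ha]

theorem continuous_starMap {Y : Type*} [TopologicalSpace Y] {n : ℕ} {a : Fin n → ℝ → Y} {p : Y}
    (ha : ∀ i, a i 0 = p) (hc : ∀ i, ContinuousOn (a i) (Ico 0 1)) : Continuous (starMap a) := by
  let C : Fin n → Set (Star n) := fun i => {x | ∃ t ∈ Ico (0 : ℝ) 1, (x : Fin n → ℝ) = Pi.single i t}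
  have hC : ∀ i, C i = {x : Star n | ∀ k, k ≠ i → (x : Fin n → ℝ) k = 0} := by
    intro i
    ext x
    constructor
    · rintro ⟨t, -, hx⟩ k hk
      rw [hx, Pi.single_eq_of_ne hk]
    · intro hx
      obtain ⟨j, t, ht, hxj⟩ := x.2
      by_cases hij : j = i
      · subst hij
        exact ⟨t, ht, hxj⟩
      · have := hx j hij
        rw [hxj, Pi.single_eq_same] at this
        refine ⟨0, ⟨le_rfl, zero_lt_one⟩, ?_⟩
        rw [hxj, this, Pi.single_zero, Pi.single_zero]
  refine (locallyFinite_of_finite C).continuous ?_ ?_ ?_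
  · refine eq_univ_of_forall fun x => ?_
    obtain ⟨i, h⟩ := x.2
    exact mem_iUnion.2 ⟨i, h⟩
  · intro i
    rw [hC i]
    have : {x : Star n | ∀ k, k ≠ i → (x : Fin n → ℝ) k = 0} =
        ⋂ k, ⋂ (_ : k ≠ i), {x : Star n | (x : Fin n → ℝ) k = 0} := by
      ext x; simp
    rw [this]
    exact isClosed_iInter fun k => isClosed_iInter fun _ =>
      isClosed_eq ((continuous_apply k).comp continuous_subtype_val) continuous_const
  · intro i
    have h1 : ContinuousOn (fun x : Star n => a i ((x : Fin n → ℝ) i)) (C i) := by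
      refine (hc i).comp ((continuous_apply i).comp continuous_subtype_val).continuousOn ?_
      rintro x ⟨t, ht, hx⟩
      simp only
      rw [hx, Pi.single_eq_same]
      exact ht
    refine h1.congr ?_
    rintro x ⟨t, ht, hx⟩
    simp only [starMap_single ha hx, hx, Pi.single_eq_same]

namespace MetricGraph

variable {G : MetricGraph}

/-! ### Maximal star neighborhoods -/

theorem IsCore.one_lt_card_direction {n : ℕ} (hG : G.IsCore n) (p : G.Point) :
    1 < Nat.card {d : G.Edge × Bool // ∃ u, 0 ≤ u ∧ u < G.len d.1 ∧ G.path d u = p} := by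
  by_cases hp : p ∈ G.vert
  · have h1 := hG.three_le_valence p hp
    unfold valence at h1
    have h2 : Nat.card {d : G.Edge × Bool // G.path d 0 = p} ≤
        Nat.card {d : G.Edge × Bool // ∃ u, 0 ≤ u ∧ u < G.len d.1 ∧ G.path d u = p} :=
      Nat.card_le_card_of_injective
        (fun d => ⟨d.1, 0, le_rfl, G.len_pos _, d.2⟩)
        (fun a b h => Subtype.ext (congrArg (fun z => z.1) h))
    omega
  · obtain ⟨e, u, hu, rfl⟩ := exists_edgeInterior hp
    rw [Finite.one_lt_card_iff_nontrivial]
    refine ⟨⟨⟨(e, true), u, hu.1.le, hu.2, path_true e u⟩,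
      ⟨(e, false), G.len e - u, by linarith [hu.2], by linarith [hu.1], ?_⟩, ?_⟩⟩
    · rw [path_false, sub_sub_cancel]
    · intro h
      simpa using congrArg (fun z => z.1.2) h

/-- In a direction at a point, there is a first point of a finite set that contains the
vertices. -/
theorem exists_first_mem {O : Set G.Point} (hO : O.Finite) (hvert : G.vert ⊆ O)
    (d : G.Edge × Bool) {u : ℝ} (hu : 0 ≤ u) (hul : u < G.len d.1) :
    ∃ R, 0 < R ∧ u + R ≤ G.len d.1 ∧ G.path d (u + R) ∈ O ∧
      ∀ r ∈ Ioo 0 R, G.path d (u + r) ∉ O := by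
  have hfin : ({v | v ∈ Icc 0 (G.len d.1) ∧ G.path d v ∈ O} ∩ Ioi u).Finite :=
    (finite_path_preimage d hO).subset inter_subset_left
  obtain ⟨v, ⟨⟨hvI, hvO⟩, hvu⟩, hvmin⟩ := hfin.isCompact.exists_isLeast
    ⟨G.len d.1, ⟨⟨(G.len_pos _).le, le_rfl⟩, hvert (path_len_mem d)⟩, hul⟩
  have hvu' : u < v := hvu
  refine ⟨v - u, by linarith, by linarith [hvI.2], by rwa [add_sub_cancel], fun r hr hrO => ?_⟩
  have := hvmin ⟨⟨⟨by linarith [hr.1], by linarith [hr.2, hvI.2]⟩, hrO⟩,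
    show u < u + r by linarith [hr.1]⟩
  linarith [hr.2]

/-- A segment of a directed edge with interior disjoint from `O` does not return to its initial
point, since the mid-points of the loops are in `O`. -/
theorem path_end_ne {O : Set G.Point}
    (hloop : ∀ e, G.chart e 0 = G.chart e (G.len e) → G.chart e (G.len e / 2) ∈ O)
    {d : G.Edge × Bool} {u R : ℝ} (hu : 0 ≤ u) (hR : 0 < R) (hRl : u + R ≤ G.len d.1)
    (hmid : ∀ r ∈ Ioo 0 R, G.path d (u + r) ∉ O) : G.path d (u + R) ≠ G.path d u := by
  intro h
  rcases hu.eq_or_lt with rfl | hu0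
  · rw [zero_add] at h hRl
    have hRlen : R = G.len d.1 := by
      by_contra hne
      exact path_notMem_vert d ⟨hR, lt_of_le_of_ne hRl hne⟩ (h ▸ path_zero_mem d)
    subst hRlen
    refine hmid (G.len d.1 / 2) ⟨by linarith, by linarith⟩ ?_
    obtain ⟨e, b⟩ := d
    rw [zero_add]
    cases b
    · rw [path_false, path_false, sub_self, sub_zero] at h
      rw [path_false, show G.len e - G.len e / 2 = G.len e / 2 by ring]
      exact hloop e h
    · rw [path_true, path_true] at h
      rw [path_true]
      exact hloop e h.symm
  · rcases path_eq_path ⟨hu0, by linarith⟩ ⟨by linarith, hRl⟩ h.symm with h' | h'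
    · linarith [h'.2]
    · exact rev_ne d h'.1.symm

/-- Let `O` be a finite set that contains the vertices and the mid-points of the loops.  The
component of a point `p ∈ O` in the complement of the other points of `O` is an open star set. -/
theorem IsCore.exists_maximal_star {n : ℕ} (hG : G.IsCore n) {O : Set G.Point} (hO : O.Finite)
    (hvert : G.vert ⊆ O)
    (hloop : ∀ e, G.chart e 0 = G.chart e (G.len e) → G.chart e (G.len e / 2) ∈ O)
    {p : G.Point} (hp : p ∈ O) :
    ∃ V, IsOpen V ∧ (∃ m, IsStarSet m V p) ∧ V ⊆ insert p Oᶜ ∧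
      ∀ C ⊆ insert p Oᶜ, IsPreconnected C → (C ∩ V).Nonempty → C ⊆ V := by
  let D := {d : G.Edge × Bool // ∃ u, 0 ≤ u ∧ u < G.len d.1 ∧ G.path d u = p}
  have hcard : 1 < Nat.card D := hG.one_lt_card_direction p
  let κ : Fin (Nat.card D) ≃ D := (Finite.equivFin D).symm
  choose U hU0 hUl hUp using fun i => (κ i).2
  choose R hR hRl hRO hRmid using fun i => exists_first_mem hO hvert (κ i).1 (hU0 i) (hUl i)
  let a : Fin (Nat.card D) → ℝ → G.Point := fun i t => G.path (κ i).1 (U i + R i * t)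
  have hRt : ∀ i, ∀ t ∈ Ico (0 : ℝ) 1, 0 ≤ R i * t ∧ R i * t < R i := fun i t ht =>
    ⟨mul_nonneg (hR i).le ht.1, by nlinarith [hR i, ht.2]⟩
  have hRt0 : ∀ i, ∀ t ∈ Ioo (0 : ℝ) 1, R i * t ∈ Ioo 0 (R i) := fun i t ht =>
    ⟨mul_pos (hR i) ht.1, (hRt i t ⟨ht.1.le, ht.2⟩).2⟩
  have ha0 : ∀ i, a i 0 = p := fun i => by simp only [a, mul_zero, add_zero, hUp]
  have haO : ∀ i, ∀ t ∈ Ioo (0 : ℝ) 1, a i t ∉ O := fun i t ht => hRmid i _ (hRt0 i t ht)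
  have hacont : ∀ i, ContinuousOn (a i) (Ico 0 1) := by
    intro i
    refine (path_continuousOn (κ i).1).comp (by fun_prop) fun t ht => ?_
    have := hRt i t ht
    exact ⟨by linarith [hU0 i], by linarith [hRl i]⟩
  -- On a loop at `p`, the two opposite prongs end at the mid-point at the latest.
  have hhalf : ∀ i, U i = 0 → G.path (κ i).1 (G.len (κ i).1.1) = p →
      R i ≤ G.len (κ i).1.1 / 2 := by
    intro i hi hlen
    by_contra hlt
    push Not at hlt
    refine hRmid i (G.len (κ i).1.1 / 2) ⟨by linarith [G.len_pos (κ i).1.1], hlt⟩ ?_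
    have h0 := hUp i
    rw [hi] at h0
    rw [hi, zero_add]
    generalize (κ i).1 = d at *
    obtain ⟨e, b⟩ := d
    cases b
    · rw [path_false] at h0 hlen
      rw [path_false, show G.len e - G.len e / 2 = G.len e / 2 by ring]
      rw [sub_self] at hlen
      rw [sub_zero] at h0
      exact hloop e (hlen.trans h0.symm)
    · rw [path_true] at h0 hlen
      rw [path_true]
      exact hloop e (h0.trans hlen.symm)
  have hainj : ∀ i j, ∀ t ∈ Ico (0 : ℝ) 1, ∀ s ∈ Ico (0 : ℝ) 1, a i t = a j s →
      (i = j ∧ t = s) ∨ (t = 0 ∧ s = 0) := by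
    intro i j t ht s hs h
    rcases ht.1.eq_or_lt with rfl | ht0
    · rcases hs.1.eq_or_lt with rfl | hs0
      · exact Or.inr ⟨rfl, rfl⟩
      · exfalso
        rw [ha0] at h
        exact haO j s ⟨hs0, hs.2⟩ (h ▸ hp)
    rcases hs.1.eq_or_lt with rfl | hs0
    · exfalso
      rw [ha0] at h
      exact haO i t ⟨ht0, ht.2⟩ (h ▸ hp)
    left
    have hti := hRt0 i t ⟨ht0, ht.2⟩
    have hsj := hRt0 j s ⟨hs0, hs.2⟩
    rcases path_eq_path (d := (κ i).1) (d' := (κ j).1)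
      ⟨by linarith [hU0 i, hti.1], by linarith [hRl i, hti.2]⟩
      ⟨by linarith [hU0 j, hsj.1], by linarith [hRl j, hsj.2]⟩ h with ⟨h1, h2⟩ | ⟨h1, h2⟩
    · have hij : i = j := κ.injective (Subtype.ext h1.symm)
      subst hij
      refine ⟨rfl, ?_⟩
      have : R i * s = R i * t := by linarith
      exact (mul_left_cancel₀ (hR i).ne' this).symm
    · exfalso
      have hUj : G.path (κ i).1 (G.len (κ i).1.1 - U j) = p := by
        rw [← path_rev, ← h1, hUp]
      have hlj : U j < G.len (κ i).1.1 := by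
        have := hUl j
        rwa [h1, rev_fst] at this
      rcases (hU0 i).eq_or_lt with hi0 | hi0
      · have hpv : p ∈ G.vert := by
          rw [← hUp i, ← hi0]
          exact path_zero_mem _
        have hj0 : U j = 0 := by
          by_contra hne
          refine path_notMem_vert (κ j).1 ⟨lt_of_le_of_ne (hU0 j) (Ne.symm hne), hUl j⟩ ?_
          rw [hUp]
          exact hpv
        rw [hj0, sub_zero] at hUj
        have h3 := hhalf i hi0.symm hUj
        have h4 := hhalf j hj0 (by
          have h5 := hUp i
          rw [h1, path_rev, rev_fst, sub_self]
          rwa [← hi0] at h5)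
        rw [h1, rev_fst] at h4
        linarith [hti.2, hsj.2]
      · rcases path_eq_path ⟨hi0, hUl i⟩ ⟨by linarith, by linarith [hU0 j]⟩
          ((hUp i).trans hUj.symm) with h' | h'
        · linarith [h'.2, hti.1, hsj.1]
        · exact rev_ne _ h'.1.symm
  have hcont : Continuous (starMap a) := continuous_starMap ha0 hacont
  have hinj : Function.Injective (starMap a) := by
    intro x y hxy
    obtain ⟨i, t, ht, hx⟩ := x.2
    obtain ⟨j, s, hs, hy⟩ := y.2
    rw [starMap_single ha0 hx, starMap_single ha0 hy] at hxy
    refine Subtype.ext ?_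
    rw [hx, hy]
    rcases hainj i j t ht s hs hxy with ⟨rfl, rfl⟩ | ⟨rfl, rfl⟩
    · rfl
    · simp
  -- The images of open sets contain short segments in all directions at each of their points.
  have hopen : IsOpenMap (starMap a) := by
    intro N hN
    obtain ⟨N', hN', rfl⟩ := isOpen_induced_iff.1 hN
    have hmemW : ∀ i, ∀ t ∈ Ico (0 : ℝ) 1, (Pi.single i t : Fin (Nat.card D) → ℝ) ∈ N' →
        a i t ∈ starMap a '' (Subtype.val ⁻¹' N') := fun i t ht h =>
      ⟨⟨_, single_mem_star i ht⟩, h, starMap_single ha0 rfl⟩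
    have hprong : ∀ i, ∀ t ∈ Ico (0 : ℝ) 1, (Pi.single i t : Fin (Nat.card D) → ℝ) ∈ N' →
        ∀ᶠ τ in 𝓝 (0 : ℝ), 0 ≤ t + τ / R i →
          G.path (κ i).1 (U i + R i * t + τ) ∈ starMap a '' (Subtype.val ⁻¹' N') := by
      intro i t ht h
      have hc : Continuous fun τ : ℝ => t + τ / R i := by fun_prop
      have h1 : ∀ᶠ τ in 𝓝 (0 : ℝ), t + τ / R i < 1 := by
        refine hc.continuousAt.eventually_lt continuousAt_const ?_
        simpa using ht.2
      have h2 : ∀ᶠ τ in 𝓝 (0 : ℝ),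
          (Pi.single i (t + τ / R i) : Fin (Nat.card D) → ℝ) ∈ N' := by
        refine ((Solenoids.continuous_single i).comp hc).continuousAt.preimage_mem_nhds
          (hN'.mem_nhds ?_)
        simpa using h
      filter_upwards [h1, h2] with τ h1 h2 h0
      have := hmemW i _ ⟨h0, h1⟩ h2
      simp only [a] at this
      rw [mul_add, mul_div_cancel₀ _ (hR i).ne', ← add_assoc] at this
      exact this
    refine isOpen_of_chart fun e s hs hsW => ?_
    obtain ⟨x, hxN, hxs⟩ := hsW
    obtain ⟨i, t, ht, hx⟩ := x.2
    rw [starMap_single ha0 hx] at hxs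
    have hxN' : (Pi.single i t : Fin (Nat.card D) → ℝ) ∈ N' := hx ▸ hxN
    rcases ht.1.eq_or_lt with rfl | ht0
    · rw [ha0] at hxs
      rw [Pi.single_zero] at hxN'
      have hdir : ∀ (d : G.Edge × Bool) (u : ℝ), 0 ≤ u → u < G.len d.1 → G.path d u = p →
          ∀ᶠ τ in 𝓝 (0 : ℝ), 0 ≤ τ →
            G.path d (u + τ) ∈ starMap a '' (Subtype.val ⁻¹' N') := by
        intro d u hu hul hup
        obtain ⟨k, hk⟩ := κ.surjective ⟨d, u, hu, hul, hup⟩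
        have hk1 : (κ k).1 = d := congrArg Subtype.val hk
        have hkU : U k = u := by
          refine path_injOn_Ico d ⟨hU0 k, ?_⟩ ⟨hu, hul⟩ ?_
          · have := hUl k
            rwa [hk1] at this
          · rw [hup, ← hUp k, hk1]
        have := hprong k 0 ⟨le_rfl, zero_lt_one⟩ (by rw [Pi.single_zero]; exact hxN')
        rw [hk1, hkU, mul_zero, add_zero] at this
        filter_upwards [this] with τ h hτ
        exact h (by have := hR k; positivity)
      have hr : ∀ᶠ s' in 𝓝 s, s' ∈ Icc 0 (G.len e) → s < s' →
          G.chart e s' ∈ starMap a '' (Subtype.val ⁻¹' N') := by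
        by_cases hsl : s < G.len e
        · have hlim : Filter.Tendsto (fun s' : ℝ => s' - s) (𝓝 s) (𝓝 0) := by
            have : Continuous fun s' : ℝ => s' - s := by fun_prop
            simpa using this.tendsto s
          filter_upwards [hlim.eventually (hdir (e, true) s hs.1 hsl
            (by rw [path_true]; exact hxs.symm))] with s' h _ hss'
          have := h (by linarith)
          rwa [path_true, add_sub_cancel] at this
        · refine Filter.Eventually.of_forall fun s' hs' hss' => ?_
          linarith [hs'.2]
      have hl : ∀ᶠ s' in 𝓝 s, s' ∈ Icc 0 (G.len e) → s' < s →
          G.chart e s' ∈ starMap a '' (Subtype.val ⁻¹' N') := by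
        by_cases hs0 : 0 < s
        · have hlim : Filter.Tendsto (fun s' : ℝ => s - s') (𝓝 s) (𝓝 0) := by
            have : Continuous fun s' : ℝ => s - s' := by fun_prop
            simpa using this.tendsto s
          filter_upwards [hlim.eventually (hdir (e, false) (G.len e - s) (by linarith [hs.2])
            (by simpa using hs0) (by rw [path_false, sub_sub_cancel]; exact hxs.symm))]
            with s' h _ hss'
          have := h (by linarith)
          rwa [path_false, show G.len e - (G.len e - s + (s - s')) = s' by ring] at this
        · refine Filter.Eventually.of_forall fun s' hs' hss' => ?_
          linarith [hs'.1]
      rw [eventually_nhdsWithin_iff]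
      filter_upwards [hr, hl] with s' h1 h2 hs'
      rcases lt_trichotomy s s' with h | h | h
      · exact h1 hs' h
      · rw [← h, ← hxs, ← ha0 i]
        exact hmemW i 0 ⟨le_rfl, zero_lt_one⟩ (by rw [Pi.single_zero]; exact hxN')
      · exact h2 hs' h
    · have hti := hRt0 i t ⟨ht0, ht.2⟩
      have hpos : ∀ᶠ τ in 𝓝 (0 : ℝ), 0 ≤ t + τ / R i := by
        have hc : Continuous fun τ : ℝ => t + τ / R i := by fun_prop
        have : ∀ᶠ τ in 𝓝 (0 : ℝ), 0 < t + τ / R i :=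
          continuousAt_const.eventually_lt hc.continuousAt (by simpa using ht0)
        exact this.mono fun _ => le_of_lt
      have hev := (hprong i t ht hxN').and hpos
      refine Filter.Eventually.filter_mono nhdsWithin_le_nhds ?_
      have hxs' : G.path (κ i).1 (U i + R i * t) = G.path (e, true) s := by
        rw [path_true]; exact hxs
      rcases path_eq_path (d := (κ i).1) ⟨by linarith [hU0 i, hti.1], by linarith [hRl i, hti.2]⟩
        hs hxs' with ⟨h1, h2⟩ | ⟨h1, h2⟩
      · have hlim : Filter.Tendsto (fun s' : ℝ => s' - s) (𝓝 s) (𝓝 0) := by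
          have : Continuous fun s' : ℝ => s' - s := by fun_prop
          simpa using this.tendsto s
        filter_upwards [hlim.eventually hev] with s' h
        have := h.1 h.2
        rwa [← h2, add_sub_cancel, ← h1, path_true] at this
      · have hlim : Filter.Tendsto (fun s' : ℝ => s - s') (𝓝 s) (𝓝 0) := by
          have : Continuous fun s' : ℝ => s - s' := by fun_prop
          simpa using this.tendsto s
        have h1' : (κ i).1 = (e, false) := by
          rw [← rev_rev (κ i).1, ← h1]; rfl
        rw [h1'] at h2
        filter_upwards [hlim.eventually hev] with s' h
        have := h.1 h.2
        rw [h1', path_false] at this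
        rwa [show G.len e - (U i + R i * t + (s - s')) = s' by linarith] at this
  have hemb := Topology.IsOpenEmbedding.of_continuous_injective_isOpenMap hcont hinj hopen
  have hrange : ∀ q, q ∈ range (starMap a) ↔ ∃ i, ∃ t ∈ Ico (0 : ℝ) 1, a i t = q := by
    intro q
    constructor
    · rintro ⟨x, rfl⟩
      obtain ⟨i, t, ht, hx⟩ := x.2
      exact ⟨i, t, ht, (starMap_single ha0 hx).symm⟩
    · rintro ⟨i, t, ht, rfl⟩
      exact ⟨⟨_, single_mem_star i ht⟩, starMap_single ha0 rfl⟩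
  refine ⟨range (starMap a), hemb.isOpen_range, ⟨Nat.card D, isStarSet_range hcard
    hemb.isEmbedding fun x hx => ?_⟩, ?_, ?_⟩
  · rw [starMap_single ha0 (i := ⟨0, by omega⟩) (t := 0) (by rw [hx, Pi.single_zero]), ha0]
  · intro q hq
    obtain ⟨i, t, ht, rfl⟩ := (hrange q).1 hq
    rcases ht.1.eq_or_lt with rfl | ht0
    · exact Or.inl (ha0 i)
    · exact Or.inr (haO i t ⟨ht0, ht.2⟩)
  · intro C hCO hC hne
    refine hC.subset_of_closure_inter_subset hemb.isOpen_range hne ?_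
    let K : Set G.Point := ⋃ i, G.path (κ i).1 '' Icc (U i) (U i + R i)
    have hK : IsClosed K := isClosed_iUnion_of_finite fun i => IsCompact.isClosed <|
      isCompact_Icc.image_of_continuousOn ((path_continuousOn _).mono
        (Icc_subset_Icc (hU0 i) (hRl i)))
    have hsub : range (starMap a) ⊆ K := by
      intro q hq
      obtain ⟨i, t, ht, rfl⟩ := (hrange q).1 hq
      have := hRt i t ht
      exact mem_iUnion.2 ⟨i, _, ⟨by linarith, by linarith⟩, rfl⟩
    rintro q ⟨hq, hqC⟩
    obtain ⟨i, v, hv, rfl⟩ := mem_iUnion.1 (closure_minimal hsub hK hq)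
    rcases hv.2.eq_or_lt with rfl | hvlt
    · exfalso
      rcases hCO hqC with h | h
      · have h' : G.path (κ i).1 (U i + R i) = p := h
        exact path_end_ne hloop (hU0 i) (hR i) (hRl i) (hRmid i) (h'.trans (hUp i).symm)
      · exact h (hRO i)
    · rw [hrange]
      refine ⟨i, (v - U i) / R i, ⟨div_nonneg (by linarith [hv.1]) (hR i).le, ?_⟩, ?_⟩
      · rw [div_lt_one (hR i)]
        linarith
      · simp only [a]
        rw [mul_div_cancel₀ _ (hR i).ne', add_sub_cancel]

end MetricGraph

namespace GraphSequence

open MetricGraph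

variable {ζ : GraphSequence}

/-! ### Plaques -/

theorem exists_path_of_joinedIn {Y : Type*} [TopologicalSpace Y] {F : Set Y} {x y : Y}
    (h : JoinedIn F x y) :
    ∃ ω : ℝ → Y, Continuous ω ∧ ω 0 = x ∧ ω 1 = y ∧ ∀ t, ω t ∈ F := by
  refine ⟨h.somePath.extend, h.somePath.continuous_extend, h.somePath.extend_zero,
    h.somePath.extend_one, fun t => ?_⟩
  obtain ⟨s, hs⟩ := h.somePath.extend_range ▸ mem_range_self (f := h.somePath.extend) t
  rw [← hs]
  exact h.somePath_mem s

theorem joinedIn_of_path {Y : Type*} [TopologicalSpace Y] {F : Set Y} {γ : ℝ → Y}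
    (hγ : Continuous γ) {r a b : ℝ} (hF : ∀ s ∈ Icc 0 r, γ s ∈ F) (ha : a ∈ Icc 0 r)
    (hb : b ∈ Icc 0 r) : JoinedIn F (γ a) (γ b) := by
  have hI : IsPathConnected (Icc (0 : ℝ) r) := (convex_Icc 0 r).isPathConnected ⟨a, ha⟩
  exact ((hI.image hγ).joinedIn _ ⟨a, ha, rfl⟩ _ ⟨b, hb, rfl⟩).mono
    (by rintro _ ⟨s, hs, rfl⟩; exact hF s hs)

theorem proj_mem_of_mem_pathComponentIn {k : ℕ} {V : Set (ζ.G k).Point} {x z : ζ.X}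
    (h : z ∈ pathComponentIn (ζ.proj k ⁻¹' V) x) : ζ.proj k z ∈ V :=
  JoinedIn.target_mem (F := ζ.proj k ⁻¹' V) h

/-- A plaque contains at most one point over the center of the neighborhood. -/
theorem IsSplitSequence.eq_of_joinedIn_center {n : ℕ} (hs : ζ.IsSplitSequence n) {k : ℕ}
    {V : Set (ζ.G k).Point} {p : (ζ.G k).Point} (hV : V ⊆ insert p (ζ.overOptimal k)ᶜ)
    (hloop : ∀ e, (ζ.G k).chart e 0 = p → (ζ.G k).chart e ((ζ.G k).len e) = p →
      (ζ.G k).chart e ((ζ.G k).len e / 2) ∉ V)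
    {x y : ζ.X} (hx : ζ.proj k x = p) (hy : ζ.proj k y = p)
    (h : JoinedIn (ζ.proj k ⁻¹' V) x y) {l : ℕ} (hkl : k ≤ l) : ζ.proj l x = ζ.proj l y := by
  obtain ⟨ω, hω, rfl, rfl, hωF⟩ := exists_path_of_joinedIn h
  refine (hs.isUnitSpeed_comp hkl).eq_of_path_over (hs.noBacktracking_comp hkl)
    (hs.continuous_comp hkl) (V := V) (p := p) (hs.finite_comp_preimage hkl (Set.finite_singleton p))
    ?_ ?_ hloop (ω := fun t => ζ.proj l (ω t)) ((continuous_proj l).comp hω) ?_ ?_ ?_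
  · intro q hq hqV
    rcases hV hqV with h | h
    · exact h
    · exact absurd ((comp_mem_overOptimal hkl).2 (mem_overOptimal_of_mem_vert hq)) h
  · intro q hq hqV
    rcases hV hqV with h | h
    · exact h
    · exact absurd (mem_overOptimal_of_mem_vert hq) h
  · intro t _
    rw [comp_proj]
    exact hωF t
  · rw [comp_proj, hx]
  · rw [comp_proj, hy]

theorem not_isPreSingularity (hst : ζ.IsStabilized) {x : ζ.X} {k : ℕ}
    (hx : ζ.proj k x ∉ (ζ.G k).vert) : ¬ ζ.IsPreSingularity x :=
  fun h => hst.vertex_none k _ hx x h rfl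

/-- A plaque of an arc of an open edge embeds in this arc: the only point of the plaque that can be
a vertex at a given level is the one over the center, which is not a pre-singularity. -/
theorem IsSplitSequence.injOn_proj_pathComponentIn {n : ℕ} (hs : ζ.IsSplitSequence n)
    (hst : ζ.IsStabilized) {k : ℕ} {E : (ζ.G k).Edge} {V : Set (ζ.G k).Point} {x : ζ.X}
    (hVE : V ⊆ (ζ.G k).edgeInterior E) (hV : V ⊆ insert (ζ.proj k x) (ζ.overOptimal k)ᶜ)
    (hx : ζ.proj k x ∈ V) :
    InjOn (ζ.proj k) (pathComponentIn (ζ.proj k ⁻¹' V) x) := by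
  intro z hz z' hz' heq
  by_contra hne
  obtain ⟨j, hj⟩ : ∃ j, ζ.proj j z ≠ ζ.proj j z' := by
    by_contra hc
    push Not at hc
    exact hne (X_ext hc)
  have hpre := not_isPreSingularity hst (edgeInterior_disjoint_vert (hVE hx))
  unfold IsPreSingularity at hpre
  push Not at hpre
  obtain ⟨l, hl, hlv⟩ := hpre (max j k)
  have hkl : k ≤ l := (le_max_right _ _).trans hl
  have hloop : ∀ e, (ζ.G k).chart e 0 = ζ.proj k x →
      (ζ.G k).chart e ((ζ.G k).len e) = ζ.proj k x →
      (ζ.G k).chart e ((ζ.G k).len e / 2) ∉ V := fun e he =>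
    absurd ((ζ.G k).chart_zero e) (he ▸ edgeInterior_disjoint_vert (hVE hx))
  have hzz' : JoinedIn (ζ.proj k ⁻¹' V) z z' := JoinedIn.trans (JoinedIn.symm hz) hz'
  refine proj_ne_of_le ((le_max_left _ _).trans hl) hj ?_
  obtain ⟨ω, hω, rfl, rfl, hωF⟩ := exists_path_of_joinedIn hzz'
  refine (hs.isUnitSpeed_comp hkl).eq_of_path_avoiding_vert (hs.noBacktracking_comp hkl)
    (hs.continuous_comp hkl) (E := E) (ω := fun t => ζ.proj l (ω t))
    ((continuous_proj l).comp hω) ?_ ?_ ?_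
  · intro t _
    rw [comp_proj]
    exact hVE (hωF t)
  · intro t ht hv
    have h1 : JoinedIn (ζ.proj k ⁻¹' V) x (ω t) :=
      JoinedIn.trans hz (joinedIn_of_path hω (fun s _ => hωF s) ⟨le_rfl, zero_le_one⟩ ht)
    have h2 : ζ.proj k (ω t) = ζ.proj k x := by
      rcases hV (hωF t) with h | h
      · exact h
      · refine absurd ?_ h
        rw [← comp_proj hkl, comp_mem_overOptimal]
        exact mem_overOptimal_of_mem_vert hv
    have h3 := hs.eq_of_joinedIn_center hV hloop rfl h2 h1 hkl
    exact hlv (h3 ▸ hv)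
  · rw [comp_proj, comp_proj, heq]

/-- An interior point of an edge has an arc around it that contains no other optimal points. -/
theorem IsSplitSequence.exists_isolating_arc {n : ℕ} (hs : ζ.IsSplitSequence n) (hp : ζ.IsProper)
    {k : ℕ} {E : (ζ.G k).Edge} {c : ℝ} (hc : c ∈ Ioo 0 ((ζ.G k).len E)) :
    ∃ η, 0 < η ∧ 0 < c - η ∧ c + η < (ζ.G k).len E ∧
      ∀ u ∈ Ioo (c - η) (c + η), u ≠ c → (ζ.G k).chart E u ∉ ζ.overOptimal k := by
  have hfin := finite_path_preimage (E, true) (hs.finite_overOptimal hp k)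
  have hcl : IsClosed ({u | u ∈ Icc 0 ((ζ.G k).len E) ∧
      (ζ.G k).path (E, true) u ∈ ζ.overOptimal k} \ {c}) := (hfin.subset sdiff_subset).isClosed
  have h1 := hcl.isOpen_compl.mem_nhds (x := c) (fun h => h.2 rfl)
  obtain ⟨ε, hε, hball⟩ := Metric.mem_nhds_iff.1 (Filter.inter_mem h1 (Ioo_mem_nhds hc.1 hc.2))
  rw [Real.ball_eq_Ioo] at hball
  refine ⟨ε / 2, by positivity, ?_, ?_, ?_⟩
  · exact (hball ⟨by linarith, by linarith⟩ : c - ε / 2 ∈ _).2.1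
  · exact (hball ⟨by linarith, by linarith⟩ : c + ε / 2 ∈ _).2.2
  · intro u hu huc hO
    have := hball (⟨by linarith [hu.1], by linarith [hu.2]⟩ : u ∈ Ioo (c - ε) (c + ε))
    refine this.1 ⟨⟨Ioo_subset_Icc_self this.2, ?_⟩, huc⟩
    rwa [path_true]

theorem isStdStarNhd_arc {k : ℕ} {E : (ζ.G k).Edge} {c η : ℝ} (hη : 0 < η) (h0 : 0 ≤ c - η)
    (h1 : c + η ≤ (ζ.G k).len E)
    (hO : ∀ u ∈ Ioo (c - η) (c + η), u ≠ c → (ζ.G k).chart E u ∉ ζ.overOptimal k) :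
    ζ.IsStdStarNhd k ((ζ.G k).chart E '' Ioo (c - η) (c + η)) ((ζ.G k).chart E c) := by
  refine ⟨isOpen_image_chart E isOpen_Ioo (Ioo_subset_Ioo h0 h1),
    ⟨2, isStarSet_two_chart hη h0 h1⟩, ?_⟩
  rintro _ ⟨u, hu, rfl⟩ hne hsp
  exact hO u hu (fun h => hne (by rw [h])) (mem_overOptimal_of_isSpecial hsp)

/-- A singularity is a natural vertex at every level: otherwise some plaque around it embeds in an
arc. -/
theorem IsSplitSequence.proj_mem_vert_of_mem_sing {n : ℕ} (hs : ζ.IsSplitSequence n)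
    (hp : ζ.IsProper) (hst : ζ.IsStabilized) {x : ζ.X} (hx : x ∈ ζ.Sing) (k : ℕ) :
    ζ.proj k x ∈ (ζ.G k).vert := by
  by_contra hv
  obtain ⟨E, c, hc, hcx⟩ := exists_edgeInterior hv
  obtain ⟨η, hη, h0, h1, hO⟩ := hs.exists_isolating_arc hp hc
  set V := (ζ.G k).chart E '' Ioo (c - η) (c + η) with hV
  have hVE : V ⊆ (ζ.G k).edgeInterior E := image_mono (Ioo_subset_Ioo h0.le h1.le)
  have hxV : ζ.proj k x ∈ V := ⟨c, ⟨by linarith, by linarith⟩, hcx⟩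
  obtain ⟨m, c', hm, -, h, -⟩ := hx (ζ.proj k ⁻¹' V)
    ⟨k, V, _, isStdStarNhd_arc hη h0.le h1.le hO, rfl⟩ hxV
  have hinj := hs.injOn_proj_pathComponentIn hst hVE (x := x) (by
    rintro _ ⟨u, hu, rfl⟩
    by_cases huc : u = c
    · exact Or.inl (by rw [huc, hcx])
    · exact Or.inr (hO u hu huc)) hxV
  have hmem : ∀ z : Star m, ζ.proj k (h z) ∈ (ζ.G k).edgeInterior E := fun z =>
    hVE (proj_mem_of_mem_pathComponentIn (h z).2)
  refine not_injective_star hm (F := fun z => (ζ.G k).coord E (ζ.proj k (h z))) ?_ ?_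
  · exact (continuousOn_coord E).comp_continuous
      ((continuous_proj k).comp (continuous_subtype_val.comp h.continuous)) hmem
  · intro z z' hzz'
    have := congrArg ((ζ.G k).chart E) hzz'
    simp only at this
    rw [chart_coord (hmem z), chart_coord (hmem z')] at this
    exact h.injective (Subtype.ext (hinj (h z).2 (h z').2 this))

/-! ### Optimal neighborhoods -/

/-- Among the pre-optimal star neighborhoods of an optimal point there is a largest one, the
component of the point in the complement of the other optimal points. -/
theorem IsSplitSequence.exists_isOptimalStarNhd {n : ℕ} (hs : ζ.IsSplitSequence n)
    (hp : ζ.IsProper) {p : (ζ.G 0).Point} (hpO : p ∈ ζ.overOptimal 0) :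
    ∃ V, ζ.IsPreOptimal 0 V p ∧ (∀ V', ζ.IsPreOptimal 0 V' p → V' ⊆ V) ∧
      V ⊆ insert p (ζ.overOptimal 0)ᶜ ∧
      ∀ C ⊆ insert p (ζ.overOptimal 0)ᶜ, IsPreconnected C → (C ∩ V).Nonempty → C ⊆ V := by
  obtain ⟨V, hVo, ⟨m, hVs⟩, hVO, hVC⟩ := (hs.core 0).exists_maximal_star
    hp.finite_overOptimal_zero (fun q hq => mem_overOptimal_of_mem_vert hq)
    (fun e he => mem_overOptimal_zero.2 (Or.inr ⟨e, he, rfl⟩)) hpO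
  refine ⟨V, ⟨⟨hVo, ⟨m, hVs⟩, fun q hq hqp hsp => ?_⟩, mem_overOptimal_zero.1 hpO,
    fun q hq hqp hop => ?_⟩, ?_, hVO, hVC⟩
  · exact (hVO hq).elim hqp fun h => h (mem_overOptimal_of_isSpecial hsp)
  · exact (hVO hq).elim hqp fun h => h (mem_overOptimal_zero.2 hop)
  · rintro V' ⟨⟨-, ⟨m', hs'⟩, -⟩, -, hV'⟩
    refine hVC V' (fun q hq => ?_) hs'.isPreconnected ⟨p, hs'.center_mem, hVs.center_mem⟩
    by_cases hqp : q = p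
    · exact Or.inl hqp
    · exact Or.inr fun h => hV' q hq hqp (mem_overOptimal_zero.1 h)

/-- An optimal star neighborhood is a component of the complement of the optimal points other than
its center. -/
theorem IsSplitSequence.isOptimalStarNhd_spec {n : ℕ} (hs : ζ.IsSplitSequence n)
    (hp : ζ.IsProper) {V : Set (ζ.G 0).Point} (hV : ζ.IsOptimalStarNhd 0 V) :
    ∃ p ∈ V, p ∈ ζ.overOptimal 0 ∧ ζ.IsStdStarNhd 0 V p ∧ V ⊆ insert p (ζ.overOptimal 0)ᶜ ∧
      ∀ C ⊆ insert p (ζ.overOptimal 0)ᶜ, IsPreconnected C → (C ∩ V).Nonempty → C ⊆ V := by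
  obtain ⟨p, hpre, hmax⟩ := hV
  have hpO := mem_overOptimal_zero.2 hpre.2.1
  obtain ⟨V', hV', hV'max, h1, h2⟩ := hs.exists_isOptimalStarNhd hp hpO
  obtain rfl := hmax V' hV' (hV'max V hpre)
  exact ⟨p, hpre.1.2.1.choose_spec.center_mem, hpO, hpre.1, h1, h2⟩

theorem IsSplitSequence.exists_isOptimalStarNhd_mem {n : ℕ} (hs : ζ.IsSplitSequence n)
    (hp : ζ.IsProper) {p : (ζ.G 0).Point} (hpO : p ∈ ζ.overOptimal 0) :
    ∃ V, ζ.IsOptimalStarNhd 0 V ∧ p ∈ V := by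
  obtain ⟨V, hV, hmax, -, -⟩ := hs.exists_isOptimalStarNhd hp hpO
  exact ⟨V, ⟨p, hV, fun V' hV' hsub => (hmax V' hV').antisymm hsub⟩,
    hV.1.2.1.choose_spec.center_mem⟩

/-- There is only one optimal star neighborhood of an optimal point. -/
theorem IsSplitSequence.isOptimalStarNhd_unique {n : ℕ} (hs : ζ.IsSplitSequence n)
    (hp : ζ.IsProper) {V V' : Set (ζ.G 0).Point} (hV : ζ.IsOptimalStarNhd 0 V)
    (hV' : ζ.IsOptimalStarNhd 0 V') {q : (ζ.G 0).Point} (hq : q ∈ V) (hq' : q ∈ V')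
    (hqO : q ∈ ζ.overOptimal 0) : V = V' := by
  obtain ⟨p, hpV, -, hst, hVO, hVC⟩ := hs.isOptimalStarNhd_spec hp hV
  obtain ⟨p', hpV', -, hst', hVO', hVC'⟩ := hs.isOptimalStarNhd_spec hp hV'
  obtain rfl : q = p := (hVO hq).resolve_right fun h => h hqO
  obtain rfl : q = p' := (hVO' hq').resolve_right fun h => h hqO
  obtain ⟨-, ⟨m, hm⟩, -⟩ := hst
  obtain ⟨-, ⟨m', hm'⟩, -⟩ := hst'
  exact (hVC' V hVO hm.isPreconnected ⟨q, hq, hq'⟩).antisymm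
    (hVC V' hVO' hm'.isPreconnected ⟨q, hq', hq⟩)

/-! ### Optimal leaf segments -/

/-- The plaque of a non-singular point over an optimal point is non-singular, since a singularity
in it would lie over the same optimal point. -/
theorem IsSplitSequence.isOptimalLeafSegment {n : ℕ} (hs : ζ.IsSplitSequence n)
    (hp : ζ.IsProper) (hst : ζ.IsStabilized) {x : ζ.X} (hx : x ∉ ζ.Sing)
    (hxO : ζ.proj 0 x ∈ ζ.overOptimal 0) {V : Set (ζ.G 0).Point} (hV : ζ.IsOptimalStarNhd 0 V)
    (hxV : ζ.proj 0 x ∈ V) : ζ.IsOptimalLeafSegment (pathComponentIn (ζ.proj 0 ⁻¹' V) x) := by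
  obtain ⟨p, hpV, hpO, hstd, hVO, -⟩ := hs.isOptimalStarNhd_spec hp hV
  refine ⟨⟨V, hV, x, hxV, rfl⟩, ⟨_, ⟨0, V, p, hstd, rfl⟩, x, hxV, rfl⟩, ?_⟩
  rintro ⟨-, m, s, hsS, hstar⟩
  have hsQ : JoinedIn (ζ.proj 0 ⁻¹' V) x s := hstar.center_mem
  have hsv := hs.proj_mem_vert_of_mem_sing hp hst hsS 0
  have hsp : ζ.proj 0 s = p := (hVO hsQ.target_mem).resolve_right fun h =>
    h (mem_overOptimal_of_mem_vert hsv)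
  have hxp : ζ.proj 0 x = p := (hVO hxV).resolve_right fun h => h hxO
  have hloop : ∀ e, (ζ.G 0).chart e 0 = p → (ζ.G 0).chart e ((ζ.G 0).len e) = p →
      (ζ.G 0).chart e ((ζ.G 0).len e / 2) ∉ V := by
    intro e h0 h1 hmem
    have hlen := (ζ.G 0).len_pos e
    have hnv := (ζ.G 0).chart_notMem_vert e ((ζ.G 0).len e / 2) ⟨by linarith, by linarith⟩
    rcases hVO hmem with h | h
    · exact hnv (by rw [h, ← h0]; exact (ζ.G 0).chart_zero e)
    · exact h (mem_overOptimal_zero.2 (Or.inr ⟨e, h0.trans h1.symm, rfl⟩))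
  have : x = s := X_ext fun j => hs.eq_of_joinedIn_center hVO hloop hxp hsp hsQ (Nat.zero_le j)
  exact hx (this ▸ hsS)

theorem IsOptimalLeafSegment.eq_pathComponentIn {Q : Set ζ.X} (hQ : ζ.IsOptimalLeafSegment Q)
    {x : ζ.X} (hx : x ∈ Q) :
    ∃ V, ζ.IsOptimalStarNhd 0 V ∧ ζ.proj 0 x ∈ V ∧ Q = pathComponentIn (ζ.proj 0 ⁻¹' V) x := by
  obtain ⟨⟨V, hV, y, hy, rfl⟩, -⟩ := hQ
  exact ⟨V, hV, proj_mem_of_mem_pathComponentIn hx, (pathComponentIn_congr hx).symm⟩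

/-- A path that meets an optimal leaf segment stays in it as long as it passes over no further
optimal points. -/
theorem IsSplitSequence.path_mem_optimalLeafSegment {n : ℕ} (hs : ζ.IsSplitSequence n)
    (hp : ζ.IsProper) {Q : Set ζ.X} (hQ : ζ.IsOptimalLeafSegment Q) {γ : ℝ → ζ.X}
    (hγ : Continuous γ) {r s₀ : ℝ} (hs₀ : s₀ ∈ Icc 0 r) (hmem : γ s₀ ∈ Q)
    (hO : ∀ s ∈ Icc 0 r, ζ.proj 0 (γ s) ∈ insert (ζ.proj 0 (γ s₀)) (ζ.overOptimal 0)ᶜ) :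
    ∀ s ∈ Icc 0 r, γ s ∈ Q := by
  obtain ⟨V, hV, hxV, rfl⟩ := hQ.eq_pathComponentIn hmem
  obtain ⟨p, hpV, hpO, hstd, hVO, hVC⟩ := hs.isOptimalStarNhd_spec hp hV
  have hC : (fun s => ζ.proj 0 (γ s)) '' Icc 0 r ⊆ V := by
    refine hVC _ ?_ (isPreconnected_Icc.image _ ((continuous_proj 0).comp hγ).continuousOn)
      ⟨_, ⟨s₀, hs₀, rfl⟩, hxV⟩
    rintro _ ⟨s, hs', rfl⟩
    rcases hO s hs' with h | h
    · simp only
      rw [h]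
      exact hVO hxV
    · exact Or.inr h
  intro s hs'
  exact joinedIn_of_path hγ (F := ζ.proj 0 ⁻¹' V) (fun t ht => hC ⟨t, ht, rfl⟩) hs₀ hs'

/-- A point over no optimal point has arbitrarily small leaf segments around it. -/
theorem IsSplitSequence.exists_isLeafSegment {n : ℕ} (hs : ζ.IsSplitSequence n)
    (hp : ζ.IsProper) (hst : ζ.IsStabilized) {y : ζ.X} (hy : ζ.proj 0 y ∉ ζ.overOptimal 0)
    {U : Set (ζ.G 0).Point} (hU : IsOpen U) (hyU : ζ.proj 0 y ∈ U) :
    ∃ M, ζ.IsLeafSegment M ∧ M ⊆ pathComponentIn (ζ.proj 0 ⁻¹' U) y := by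
  obtain ⟨E, c, hc, hcy⟩ := exists_edgeInterior fun h => hy (mem_overOptimal_of_mem_vert h)
  obtain ⟨η, hη, h0, h1, hO⟩ := hs.exists_isolating_arc hp hc
  have hO' : ∀ u ∈ Ioo (c - η) (c + η), (ζ.G 0).chart E u ∉ ζ.overOptimal 0 := by
    intro u hu
    by_cases huc : u = c
    · rw [huc, hcy]; exact hy
    · exact hO u hu huc
  -- A smaller radius, for which the arc lies in `U` and its closure still avoids optimal points.
  obtain ⟨ρ, hρ, hρη, hρU⟩ : ∃ ρ, 0 < ρ ∧ ρ < η ∧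
      (ζ.G 0).chart E '' Ioo (c - ρ) (c + ρ) ⊆ U := by
    have hcont : ContinuousAt ((ζ.G 0).chart E) c :=
      ((ζ.G 0).chart_continuousOn E).continuousAt (Icc_mem_nhds hc.1 hc.2)
    obtain ⟨ε, hε, hball⟩ := Metric.mem_nhds_iff.1
      (hcont.preimage_mem_nhds (hU.mem_nhds (hcy ▸ hyU)))
    rw [Real.ball_eq_Ioo] at hball
    refine ⟨min ε (η / 2), lt_min hε (by linarith), ?_, ?_⟩
    · linarith [min_le_right ε (η / 2)]
    · rintro _ ⟨u, hu, rfl⟩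
      have := min_le_left ε (η / 2)
      exact hball ⟨by linarith [hu.1], by linarith [hu.2]⟩
  set V := (ζ.G 0).chart E '' Ioo (c - η) (c + η) with hV
  set W := (ζ.G 0).chart E '' Ioo (c - ρ) (c + ρ) with hW
  have hIoo : Ioo (c - ρ) (c + ρ) ⊆ Ioo (c - η) (c + η) :=
    Ioo_subset_Ioo (by linarith) (by linarith)
  have hIE : Ioo (c - η) (c + η) ⊆ Ioo 0 ((ζ.G 0).len E) := Ioo_subset_Ioo h0.le h1.le
  have hVE : V ⊆ (ζ.G 0).edgeInterior E := image_mono hIE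
  have hyV : ζ.proj 0 y ∈ V := ⟨c, ⟨by linarith, by linarith⟩, hcy⟩
  have hyW : ζ.proj 0 y ∈ W := ⟨c, ⟨by linarith, by linarith⟩, hcy⟩
  have hinj := hs.injOn_proj_pathComponentIn hst hVE (x := y) (by
    rintro _ ⟨u, hu, rfl⟩
    exact Or.inr (hO' u hu)) hyV
  -- The arc lifts backwards from `y`, and then forwards from the initial point.
  obtain ⟨γ₁, hγ₁, hγ₁p, hγ₁0⟩ := hs.exists_lift hst y (d := (E, false))
    (w := (ζ.G 0).len E - c) hρ (by linarith) (by simp only; linarith) (by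
      intro s hs'
      rw [path_false, show (ζ.G 0).len E - ((ζ.G 0).len E - c + s) = c - s by ring]
      exact hO' _ ⟨by linarith [hs'.2], by linarith [hs'.1]⟩)
    (by rw [path_false, sub_sub_cancel, hcy])
  obtain ⟨γ, hγ, hγp, hγ0⟩ := hs.exists_lift hst (γ₁ ρ) (d := (E, true)) (w := c - ρ) (r := 2 * ρ)
    (by linarith) (by linarith) (by simp only; linarith) (by
      intro s hs'
      rw [path_true]
      exact hO' _ ⟨by linarith [hs'.1], by linarith [hs'.2]⟩)
    (by
      rw [hγ₁p ρ ⟨hρ.le, le_rfl⟩, path_false, path_true]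
      congr 1
      ring)
  have hγ₁V : ∀ s ∈ Icc 0 ρ, γ₁ s ∈ ζ.proj 0 ⁻¹' V := by
    intro s hs'
    rw [mem_preimage, hγ₁p s hs', path_false]
    exact ⟨_, ⟨by linarith [hs'.2], by linarith [hs'.1]⟩, rfl⟩
  have hγV : ∀ s ∈ Icc 0 (2 * ρ), γ s ∈ ζ.proj 0 ⁻¹' V := by
    intro s hs'
    rw [mem_preimage, hγp s hs', path_true]
    exact ⟨_, ⟨by linarith [hs'.1], by linarith [hs'.2]⟩, rfl⟩
  have hγmem : ∀ s ∈ Icc 0 (2 * ρ), γ s ∈ pathComponentIn (ζ.proj 0 ⁻¹' V) y := by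
    intro s hs'
    have j1 := joinedIn_of_path hγ₁ hγ₁V ⟨le_rfl, hρ.le⟩ ⟨hρ.le, le_rfl⟩
    have j2 := joinedIn_of_path hγ hγV ⟨le_rfl, by linarith⟩ hs'
    rw [hγ₁0] at j1
    rw [hγ0] at j2
    exact JoinedIn.trans j1 j2
  let j : ℝ → ζ.X := fun t => γ (t - (c - ρ))
  have hj : Continuous j := hγ.comp (by fun_prop)
  have hjp : ∀ t ∈ Ioo (c - ρ) (c + ρ), ζ.proj 0 (j t) = (ζ.G 0).chart E t := by
    intro t ht
    have := hγp (t - (c - ρ)) ⟨by linarith [ht.1], by linarith [ht.2]⟩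
    rwa [path_true, add_sub_cancel] at this
  have hjmem : ∀ t ∈ Ioo (c - ρ) (c + ρ), j t ∈ pathComponentIn (ζ.proj 0 ⁻¹' V) y :=
    fun t ht => hγmem _ ⟨by linarith [ht.1], by linarith [ht.2]⟩
  have hcI : c ∈ Ioo (c - ρ) (c + ρ) := ⟨by linarith, by linarith⟩
  have hjc : j c = y := hinj (hjmem c hcI) (mem_pathComponentIn_self hyV) (by rw [hjp c hcI, hcy])
  have hM : pathComponentIn (ζ.proj 0 ⁻¹' W) y = j '' Ioo (c - ρ) (c + ρ) := by
    apply Subset.antisymm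
    · intro z hz
      obtain ⟨t, ht, htz⟩ := pathComponentIn_subset hz
      refine ⟨t, ht, hinj (hjmem t ht) (pathComponentIn_mono ?_ hz) (by rw [hjp t ht, htz])⟩
      exact preimage_mono (image_mono hIoo)
    · rw [← hjc]
      have hconn : IsPathConnected (Ioo (c - ρ) (c + ρ)) :=
        (convex_Ioo _ _).isPathConnected ⟨c, hcI⟩
      refine (hconn.image hj).subset_pathComponentIn ⟨c, hcI, rfl⟩ ?_
      rintro _ ⟨t, ht, rfl⟩
      exact ⟨t, ht, (hjp t ht).symm⟩
  have hjE : ∀ z ∈ j '' Ioo (c - ρ) (c + ρ), ζ.proj 0 z ∈ (ζ.G 0).edgeInterior E := by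
    rintro _ ⟨t, ht, rfl⟩
    rw [hjp t ht]
    exact ⟨t, hIE (hIoo ht), rfl⟩
  obtain ⟨h, -⟩ := exists_homeomorph_star_two (j := j)
    (g := fun z => (ζ.G 0).coord E (ζ.proj 0 z)) hρ hj.continuousOn
    ((continuousOn_coord E).comp (continuous_proj 0).continuousOn hjE) (fun t ht => by
      rw [hjp t ht, coord_chart (hIE (hIoo ht))])
  have hplaque : ζ.IsStdPlaque (pathComponentIn (ζ.proj 0 ⁻¹' W) y) :=
    ⟨_, ⟨0, W, _, isStdStarNhd_arc hρ (by linarith) (by linarith)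
      (fun u hu _ => hO' u (hIoo hu)), rfl⟩, y, hyW, rfl⟩
  refine ⟨pathComponentIn (ζ.proj 0 ⁻¹' W) y, ⟨⟨_, hplaque, ?_⟩, hplaque, ?_⟩,
    pathComponentIn_mono (preimage_mono hρU)⟩
  · rw [hM]
    exact isTurnOf_self h
  · rintro ⟨-, m, s, hsS, hstar⟩
    exact edgeInterior_disjoint_vert (hjE s (hM ▸ hstar.center_mem))
      (hs.proj_mem_vert_of_mem_sing hp hst hsS 0)

/-- An optimal leaf segment contains a point over no optimal point. -/
theorem IsSplitSequence.exists_mem_notMem_overOptimal {n : ℕ} (hs : ζ.IsSplitSequence n)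
    (hp : ζ.IsProper) {Q : Set ζ.X} (hQ : ζ.IsOptimalLeafSegment Q) {x : ζ.X} (hx : x ∈ Q) :
    ∃ y ∈ Q, ζ.proj 0 y ∉ ζ.overOptimal 0 := by
  obtain ⟨d, w, hw, hwl, hwx, hlift⟩ := hs.exists_lift_of_point 0 x
  obtain ⟨R, hR, hRl, -, hRmid⟩ := exists_first_mem hp.finite_overOptimal_zero
    (fun q hq => mem_overOptimal_of_mem_vert hq) d hw hwl
  obtain ⟨γ, hγ, hγp, rfl⟩ := hlift R hR hRl hRmid
  have hmem := hs.path_mem_optimalLeafSegment hp hQ hγ (r := R / 2) (s₀ := 0)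
    ⟨le_rfl, by linarith⟩ hx (by
      intro s hs'
      rcases hs'.1.eq_or_lt with rfl | h0
      · exact Or.inl rfl
      · right
        rw [hγp s ⟨hs'.1, by linarith [hs'.2]⟩]
        exact hRmid s ⟨h0, by linarith [hs'.2]⟩)
  refine ⟨γ (R / 2), hmem _ ⟨by linarith, le_rfl⟩, ?_⟩
  rw [hγp _ ⟨by linarith, by linarith⟩]
  exact hRmid _ ⟨by linarith, by linarith⟩

/-- Two optimal leaf segments with a common point have a common leaf segment: over an optimal point
they are equal, and otherwise there is a small leaf segment around the common point. -/
theorem IsSplitSequence.exists_isLeafSegment_subset_inter {n : ℕ} (hs : ζ.IsSplitSequence n)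
    (hp : ζ.IsProper) (hst : ζ.IsStabilized) {Q Q' : Set ζ.X} (hQ : ζ.IsOptimalLeafSegment Q)
    (hQ' : ζ.IsOptimalLeafSegment Q') {x : ζ.X} (hx : x ∈ Q) (hx' : x ∈ Q') :
    ∃ M, ζ.IsLeafSegment M ∧ M ⊆ Q ∩ Q' := by
  have key : ∀ y ∈ Q, y ∈ Q' → ζ.proj 0 y ∉ ζ.overOptimal 0 →
      ∃ M, ζ.IsLeafSegment M ∧ M ⊆ Q ∩ Q' := by
    intro y hy hy' hyO
    obtain ⟨V, hV, hyV, rfl⟩ := hQ.eq_pathComponentIn hy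
    obtain ⟨V', hV', hyV', rfl⟩ := hQ'.eq_pathComponentIn hy'
    obtain ⟨-, -, -, ⟨hVo, -⟩, -⟩ := hs.isOptimalStarNhd_spec hp hV
    obtain ⟨-, -, -, ⟨hVo', -⟩, -⟩ := hs.isOptimalStarNhd_spec hp hV'
    obtain ⟨M, hM, hMsub⟩ := hs.exists_isLeafSegment hp hst hyO (hVo.inter hVo') ⟨hyV, hyV'⟩
    exact ⟨M, hM, subset_inter
      (hMsub.trans (pathComponentIn_mono (preimage_mono inter_subset_left)))
      (hMsub.trans (pathComponentIn_mono (preimage_mono inter_subset_right)))⟩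
  by_cases hxO : ζ.proj 0 x ∈ ζ.overOptimal 0
  · obtain ⟨y, hy, hyO⟩ := hs.exists_mem_notMem_overOptimal hp hQ hx
    refine key y hy ?_ hyO
    obtain ⟨V, hV, hxV, rfl⟩ := hQ.eq_pathComponentIn hx
    obtain ⟨V', hV', hxV', rfl⟩ := hQ'.eq_pathComponentIn hx'
    rwa [← hs.isOptimalStarNhd_unique hp hV hV' hxV hxV' hxO]
  · exact key x hx hx' hxO

/-! ### Chains of optimal leaf segments -/

/-- `x` and `y` lie in the first and the last one of a chain of optimal leaf segments, in which
consecutive ones have common leaf segments. -/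
def LeafChain (ζ : GraphSequence) (x y : ζ.X) : Prop :=
  ∃ (m : ℕ) (L : ℕ → Set ζ.X), (∀ i ≤ m, ζ.IsOptimalLeafSegment (L i)) ∧
    (∀ i < m, ∃ M, ζ.IsLeafSegment M ∧ M ⊆ L i ∩ L (i + 1)) ∧ x ∈ L 0 ∧ y ∈ L m

theorem IsOptimalLeafSegment.leafChain {Q : Set ζ.X} (hQ : ζ.IsOptimalLeafSegment Q) {x y : ζ.X}
    (hx : x ∈ Q) (hy : y ∈ Q) : ζ.LeafChain x y :=
  ⟨0, fun _ => Q, fun _ _ => hQ, fun i hi => absurd hi (Nat.not_lt_zero i), hx, hy⟩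

theorem LeafChain.exists_optimalLeafSegment {x y : ζ.X} (h : ζ.LeafChain x y) :
    ∃ Q, ζ.IsOptimalLeafSegment Q ∧ y ∈ Q := by
  obtain ⟨m, L, hL, -, -, hy⟩ := h
  exact ⟨L m, hL m le_rfl, hy⟩

theorem LeafChain.leafEquiv {x y : ζ.X} (h : ζ.LeafChain x y) : ζ.LeafEquiv x y := by
  obtain ⟨m, L, hL, hM, hx, hy⟩ := h
  refine ⟨⋃ i < m + 1, L i, ⟨m + 1, L, fun i hi => hL i (by omega), fun i hi => hM i (by omega),
    rfl⟩, ?_, ?_⟩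
  · exact mem_biUnion (show 0 ∈ {i | i < m + 1} from Nat.succ_pos m) hx
  · exact mem_biUnion (show m ∈ {i | i < m + 1} from Nat.lt_succ_self m) hy

theorem IsSplitSequence.leafChain_trans {n : ℕ} (hs : ζ.IsSplitSequence n) (hp : ζ.IsProper)
    (hst : ζ.IsStabilized) {x y z : ζ.X} (hxy : ζ.LeafChain x y) (hyz : ζ.LeafChain y z) :
    ζ.LeafChain x z := by
  obtain ⟨m, L, hL, hM, hx, hy⟩ := hxy
  obtain ⟨m', L', hL', hM', hy', hz⟩ := hyz
  refine ⟨m + 1 + m', fun i => if i ≤ m then L i else L' (i - (m + 1)), ?_, ?_, ?_, ?_⟩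
  · intro i hi
    simp only
    split_ifs with h
    · exact hL i h
    · exact hL' _ (by omega)
  · intro i hi
    simp only
    rcases lt_trichotomy i m with h | rfl | h
    · rw [if_pos h.le, if_pos (by omega)]
      exact hM i h
    · rw [if_pos le_rfl, if_neg (by omega), Nat.sub_self]
      exact hs.exists_isLeafSegment_subset_inter hp hst (hL i le_rfl) (hL' 0 (Nat.zero_le _)) hy hy'
    · rw [if_neg (by omega), if_neg (by omega), show i + 1 - (m + 1) = i - (m + 1) + 1 by omega]
      exact hM' _ (by omega)
  · simpa using hx
  · simp only
    rw [if_neg (by omega), Nat.add_sub_cancel_left]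
    exact hz

/-- An arc of an open edge without optimal points in its interior lifts, in either direction, with
given initial point. -/
theorem IsSplitSequence.exists_lift_chart {n : ℕ} (hs : ζ.IsSplitSequence n)
    (hst : ζ.IsStabilized) {k : ℕ} {E : (ζ.G k).Edge} {t t' : ℝ}
    (ht : t ∈ Ioo 0 ((ζ.G k).len E)) (ht' : t' ∈ Ioo 0 ((ζ.G k).len E)) (hne : t ≠ t')
    (hO : ∀ v, (v ∈ Ioo t t' ∨ v ∈ Ioo t' t) → (ζ.G k).chart E v ∉ ζ.overOptimal k) {x : ζ.X}
    (hx : ζ.proj k x = (ζ.G k).chart E t) :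
    ∃ (γ : ℝ → ζ.X) (r : ℝ), 0 < r ∧ Continuous γ ∧ γ 0 = x ∧
      ζ.proj k (γ r) = (ζ.G k).chart E t' ∧
      ∀ s ∈ Icc 0 r, ∃ v ∈ uIcc t t', ζ.proj k (γ s) = (ζ.G k).chart E v := by
  rcases hne.lt_or_gt with h | h
  · obtain ⟨γ, hγ, hγp, hγ0⟩ := hs.exists_lift hst x (d := (E, true)) (w := t) (r := t' - t)
      (by linarith) ht.1 (by simp only; linarith [ht'.2]) (by
        intro s hs'
        rw [path_true]
        exact hO _ (Or.inl ⟨by linarith [hs'.1], by linarith [hs'.2]⟩))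
      (by rw [path_true, hx])
    refine ⟨γ, t' - t, by linarith, hγ, hγ0, ?_, fun s hs' => ⟨t + s, ?_, ?_⟩⟩
    · rw [hγp _ ⟨by linarith, le_rfl⟩, path_true, add_sub_cancel]
    · rw [uIcc_of_le h.le]
      exact ⟨by linarith [hs'.1], by linarith [hs'.2]⟩
    · rw [hγp s hs', path_true]
  · obtain ⟨γ, hγ, hγp, hγ0⟩ := hs.exists_lift hst x (d := (E, false))
      (w := (ζ.G k).len E - t) (r := t - t')
      (by linarith) (by linarith [ht.2]) (by simp only; linarith [ht'.1]) (by
        intro s hs'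
        rw [path_false]
        exact hO _ (Or.inr ⟨by linarith [hs'.2], by linarith [hs'.1]⟩))
      (by rw [path_false, sub_sub_cancel, hx])
    refine ⟨γ, t - t', by linarith, hγ, hγ0, ?_, fun s hs' => ⟨t - s, ?_, ?_⟩⟩
    · rw [hγp _ ⟨by linarith, le_rfl⟩, path_false]
      congr 1
      ring
    · rw [uIcc_of_ge h.le]
      exact ⟨by linarith [hs'.2], by linarith [hs'.1]⟩
    · rw [hγp s hs', path_false]
      congr 1
      ring

theorem IsSplitSequence.notMem_sing {n : ℕ} (hs : ζ.IsSplitSequence n)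
    (hp : ζ.IsProper) (hst : ζ.IsStabilized) {k : ℕ} {E : (ζ.G k).Edge} {t : ℝ}
    (ht : t ∈ Ioo 0 ((ζ.G k).len E)) {x : ζ.X} (hx : ζ.proj k x = (ζ.G k).chart E t) :
    x ∉ ζ.Sing := fun h =>
  (ζ.G k).chart_notMem_vert E t ht (hx ▸ hs.proj_mem_vert_of_mem_sing hp hst h k)

theorem proj_zero_mem_overOptimal {k : ℕ} {x : ζ.X} :
    ζ.proj 0 x ∈ ζ.overOptimal 0 ↔ ζ.proj k x ∈ ζ.overOptimal k := by
  rw [← comp_proj (Nat.zero_le k), comp_mem_overOptimal]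

theorem proj_zero_eq {k : ℕ} {x y : ζ.X} (h : ζ.proj k x = ζ.proj k y) :
    ζ.proj 0 x = ζ.proj 0 y := by
  rw [← comp_proj (Nat.zero_le k), ← comp_proj (Nat.zero_le k), h]

/-- A partial leaf that enters the interior of an edge of some level graph runs through all of it:
no pre-singularity stops it there. -/
theorem IsSplitSequence.exists_leafChain_chart {n : ℕ} (hs : ζ.IsSplitSequence n)
    (hp : ζ.IsProper) (hst : ζ.IsStabilized) {y z₀ : ζ.X} (hyz : ζ.LeafChain y z₀) {k : ℕ}
    {E : (ζ.G k).Edge} {t₀ : ℝ} (ht₀ : t₀ ∈ Ioo 0 ((ζ.G k).len E))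
    (hz₀ : ζ.proj k z₀ = (ζ.G k).chart E t₀) {t : ℝ} (ht : t ∈ Ioo 0 ((ζ.G k).len E)) :
    ∃ z, ζ.proj k z = (ζ.G k).chart E t ∧ ζ.LeafChain y z := by
  let A : Set ℝ := {t | t ∈ Ioo 0 ((ζ.G k).len E) ∧
    ∃ z, ζ.proj k z = (ζ.G k).chart E t ∧ ζ.LeafChain y z}
  have hloc : ∀ t ∈ Ioo 0 ((ζ.G k).len E), ∃ η > 0,
      Ioo (t - η) (t + η) ⊆ Ioo 0 ((ζ.G k).len E) ∧
      ∀ t' ∈ Ioo (t - η) (t + η), (t ∈ A → t' ∈ A) ∧ (t' ∈ A → t ∈ A) := by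
    intro t ht
    obtain ⟨η, hη, h0, h1, hO⟩ := hs.exists_isolating_arc hp ht
    refine ⟨η, hη, Ioo_subset_Ioo h0.le h1.le, fun t' ht' => ?_⟩
    have ht'I := Ioo_subset_Ioo h0.le h1.le ht'
    by_cases hne : t = t'
    · subst hne
      exact ⟨id, id⟩
    have hmid : ∀ v, v ∈ uIcc t t' → v ≠ t → (ζ.G k).chart E v ∉ ζ.overOptimal k := by
      intro v hv hvt
      have hsub : uIcc t t' ⊆ Ioo (t - η) (t + η) :=
        ordConnected_Ioo.uIcc_subset ⟨by linarith, by linarith⟩ ht'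
      exact hO v (hsub hv) hvt
    constructor
    · rintro ⟨-, z, hz, hyz⟩
      obtain ⟨γ, r, hr, hγ, hγ0, hγr, hγv⟩ := hs.exists_lift_chart hst ht ht'I hne (by
        rintro v (hv | hv)
        · exact hmid v (Icc_subset_uIcc (Ioo_subset_Icc_self hv)) hv.1.ne'
        · exact hmid v (Icc_subset_uIcc' (Ioo_subset_Icc_self hv)) hv.2.ne) hz
      obtain ⟨Q, hQ, hzQ⟩ := hyz.exists_optimalLeafSegment
      have hmem := hs.path_mem_optimalLeafSegment hp hQ hγ (s₀ := 0) (r := r) ⟨le_rfl, hr.le⟩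
        (hγ0 ▸ hzQ) (by
          intro s hs'
          obtain ⟨v, hv, hvs⟩ := hγv s hs'
          by_cases hvt : v = t
          · exact Or.inl (proj_zero_eq (by rw [hvs, hvt, hγ0, hz]))
          · right
            rw [mem_compl_iff, proj_zero_mem_overOptimal (k := k), hvs]
            exact hmid v hv hvt)
      exact ⟨ht'I, γ r, hγr, hs.leafChain_trans hp hst hyz
        (hQ.leafChain hzQ (hmem r ⟨hr.le, le_rfl⟩))⟩
    · rintro ⟨-, z', hz', hyz'⟩
      obtain ⟨γ, r, hr, hγ, hγ0, hγr, hγv⟩ := hs.exists_lift_chart hst ht'I ht (Ne.symm hne) (by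
        rintro v (hv | hv)
        · exact hmid v (Icc_subset_uIcc' (Ioo_subset_Icc_self hv)) hv.2.ne
        · exact hmid v (Icc_subset_uIcc (Ioo_subset_Icc_self hv)) hv.1.ne') hz'
      have hγO : ∀ s ∈ Icc 0 r, ζ.proj 0 (γ s) ∈ insert (ζ.proj 0 (γ r)) (ζ.overOptimal 0)ᶜ := by
        intro s hs'
        obtain ⟨v, hv, hvs⟩ := hγv s hs'
        by_cases hvt : v = t
        · exact Or.inl (proj_zero_eq (by rw [hvs, hvt, hγr]))
        · right
          rw [mem_compl_iff, proj_zero_mem_overOptimal (k := k), hvs]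
          exact hmid v (uIcc_comm t' t ▸ hv) hvt
      suffices h : ∃ Q, ζ.IsOptimalLeafSegment Q ∧ z' ∈ Q ∧ γ r ∈ Q by
        obtain ⟨Q, hQ, h1, h2⟩ := h
        exact ⟨ht, γ r, hγr, hs.leafChain_trans hp hst hyz' (hQ.leafChain h1 h2)⟩
      by_cases hrO : ζ.proj 0 (γ r) ∈ ζ.overOptimal 0
      · obtain ⟨V, hV, hrV⟩ := hs.exists_isOptimalStarNhd_mem hp hrO
        have hQ := hs.isOptimalLeafSegment hp hst (hs.notMem_sing hp hst ht hγr) hrO hV hrV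
        have hmem := hs.path_mem_optimalLeafSegment hp hQ hγ (s₀ := r) (r := r) ⟨hr.le, le_rfl⟩
          (mem_pathComponentIn_self hrV) hγO
        exact ⟨_, hQ, hγ0 ▸ hmem 0 ⟨le_rfl, hr.le⟩, mem_pathComponentIn_self hrV⟩
      · obtain ⟨Q, hQ, hzQ⟩ := hyz'.exists_optimalLeafSegment
        have hmem := hs.path_mem_optimalLeafSegment hp hQ hγ (s₀ := 0) (r := r) ⟨le_rfl, hr.le⟩
          (hγ0 ▸ hzQ) (by
            intro s hs'
            rcases hγO s hs' with h | h
            · right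
              rw [h]
              exact hrO
            · exact Or.inr h)
        exact ⟨Q, hQ, hzQ, hmem r ⟨hr.le, le_rfl⟩⟩
  have hAopen : IsOpen A := by
    rw [isOpen_iff_mem_nhds]
    intro t htA
    obtain ⟨η, hη, -, h⟩ := hloc t htA.1
    exact Filter.mem_of_superset (Ioo_mem_nhds (by linarith) (by linarith))
      fun t' ht' => (h t' ht').1 htA
  have hBopen : IsOpen (Ioo 0 ((ζ.G k).len E) \ A) := by
    rw [isOpen_iff_mem_nhds]
    rintro t ⟨htI, htA⟩
    obtain ⟨η, hη, hsub, h⟩ := hloc t htI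
    exact Filter.mem_of_superset (Ioo_mem_nhds (by linarith) (by linarith))
      fun t' ht' => ⟨hsub ht', fun h' => htA ((h t' ht').2 h')⟩
  have hsub : Ioo 0 ((ζ.G k).len E) ⊆ A :=
    isPreconnected_Ioo.subset_left_of_subset_union hAopen hBopen disjoint_sdiff_right
      (fun t ht => by
        by_cases h : t ∈ A
        · exact Or.inl h
        · exact Or.inr ⟨ht, h⟩) ⟨t₀, ht₀, ht₀, z₀, hz₀, hyz⟩
  exact (hsub ht).2

/-! ### Mingling and minimality -/

/-- An edge that mingles with all edges of `G_0` passes over a vertex of `G_0`. -/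
theorem IsSplitSequence.exists_comp_mem_vert {n : ℕ} (hs : ζ.IsSplitSequence n) {k : ℕ}
    (hk : 0 < k) {E : (ζ.G k).Edge} (hE : ∀ e', ζ.Mingles hk E e') :
    ∃ t ∈ Ioo 0 ((ζ.G k).len E), ζ.comp hk.le ((ζ.G k).chart E t) ∈ (ζ.G 0).vert := by
  by_contra hc
  push Not at hc
  have hpre : IsPreconnected (ζ.comp hk.le '' (ζ.G k).edgeInterior E) := by
    refine IsPreconnected.image ?_ _ (hs.continuous_comp hk.le).continuousOn
    exact isPreconnected_Ioo.image _
      (((ζ.G k).chart_continuousOn E).mono Ioo_subset_Icc_self)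
  have hv : ∀ p ∈ ζ.comp hk.le '' (ζ.G k).edgeInterior E, p ∉ (ζ.G 0).vert := by
    rintro _ ⟨_, ⟨t, ht, rfl⟩, rfl⟩
    exact hc t ht
  obtain ⟨d, -⟩ := (hs.core 0).exists_path (ζ.comp hk.le ((ζ.G k).chart E 0))
  obtain ⟨e', he'⟩ := (hs.core 0).exists_ne_edge d.1
  obtain ⟨p, hp, hpe⟩ := hE d.1
  obtain ⟨q, hq, hqe⟩ := hE e'
  exact he' (edge_unique hqe (subset_edgeInterior_of_isPreconnected hpre hv hp hpe hq))

/-- If the sequence is fully mingling, each point over no optimal point lies in an optimal leaf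
segment: on a deep edge through it, some optimal point comes next. -/
theorem IsSplitSequence.exists_optimalLeafSegment_mem {n : ℕ} (hs : ζ.IsSplitSequence n)
    (hp : ζ.IsProper) (hst : ζ.IsStabilized) (hm : ζ.IsFullyMingling) {y : ζ.X}
    (hy : ζ.proj 0 y ∉ ζ.overOptimal 0) : ∃ Q, ζ.IsOptimalLeafSegment Q ∧ y ∈ Q := by
  obtain ⟨k, hk, hmin⟩ := hm 0
  have hyk : ζ.proj k y ∉ ζ.overOptimal k := fun h => hy (proj_zero_mem_overOptimal.2 h)
  obtain ⟨E, t, ht, hty⟩ := exists_edgeInterior fun h => hyk (mem_overOptimal_of_mem_vert h)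
  obtain ⟨q, hq, hqv⟩ := hs.exists_comp_mem_vert hk (hmin E)
  let T : Set ℝ := {u | u ∈ Ioo 0 ((ζ.G k).len E) ∧ (ζ.G k).chart E u ∈ ζ.overOptimal k}
  have hTfin : T.Finite := by
    refine (finite_path_preimage (E, true) (hs.finite_overOptimal hp k)).subset ?_
    rintro u ⟨hu, huO⟩
    exact ⟨Ioo_subset_Icc_self hu, by rwa [path_true]⟩
  obtain ⟨c, ⟨hcI, hcO⟩, hcmin⟩ := hTfin.exists_minimalFor (fun u => |u - t|) T
    ⟨q, hq, (comp_mem_overOptimal hk.le).1 (mem_overOptimal_of_mem_vert hqv)⟩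
  have hne : t ≠ c := by
    rintro rfl
    exact hyk (hty ▸ hcO)
  have hmid : ∀ v ∈ uIcc t c, v ≠ c → (ζ.G k).chart E v ∉ ζ.overOptimal k := by
    intro v hv hvc hvO
    have hvI : v ∈ Ioo 0 ((ζ.G k).len E) := ordConnected_Ioo.uIcc_subset ht hcI hv
    have hlt : |v - t| < |c - t| := by
      rcases le_total t c with h | h
      · rw [uIcc_of_le h] at hv
        rw [abs_of_nonneg (by linarith [hv.1]), abs_of_nonneg (by linarith)]
        linarith [lt_of_le_of_ne hv.2 hvc]
      · rw [uIcc_of_ge h] at hv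
        rw [abs_of_nonpos (by linarith [hv.2]), abs_of_nonpos (by linarith)]
        linarith [lt_of_le_of_ne hv.1 (Ne.symm hvc)]
    exact absurd (hcmin ⟨hvI, hvO⟩ hlt.le) (not_le.2 hlt)
  obtain ⟨γ, r, hr, hγ, hγ0, hγr, hγv⟩ := hs.exists_lift_chart hst ht hcI hne (by
    rintro v (hv | hv)
    · exact hmid v (Icc_subset_uIcc (Ioo_subset_Icc_self hv)) hv.2.ne
    · exact hmid v (Icc_subset_uIcc' (Ioo_subset_Icc_self hv)) hv.1.ne') hty.symm
  have hrO : ζ.proj 0 (γ r) ∈ ζ.overOptimal 0 := by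
    rw [proj_zero_mem_overOptimal (k := k), hγr]
    exact hcO
  obtain ⟨V, hV, hrV⟩ := hs.exists_isOptimalStarNhd_mem hp hrO
  have hQ := hs.isOptimalLeafSegment hp hst (hs.notMem_sing hp hst hcI hγr) hrO hV hrV
  refine ⟨_, hQ, ?_⟩
  rw [← hγ0]
  refine hs.path_mem_optimalLeafSegment hp hQ hγ (s₀ := r) (r := r) ⟨hr.le, le_rfl⟩
    (mem_pathComponentIn_self hrV) ?_ 0 ⟨le_rfl, hr.le⟩
  intro s hs'
  obtain ⟨v, hv, hvs⟩ := hγv s hs'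
  by_cases hvc : v = c
  · exact Or.inl (proj_zero_eq (by rw [hvs, hvc, hγr]))
  · right
    rw [mem_compl_iff, proj_zero_mem_overOptimal (k := k), hvs]
    exact hmid v hv hvc

/-- The preimages of open sets of the level graphs form a basis of the solenoid. -/
theorem IsSplitSequence.exists_proj_preimage_subset {n : ℕ} (hs : ζ.IsSplitSequence n)
    {N : Set ζ.X} (hN : IsOpen N) {x : ζ.X} (hx : x ∈ N) :
    ∃ (j : ℕ) (W : Set (ζ.G j).Point), IsOpen W ∧ ζ.proj j x ∈ W ∧ ζ.proj j ⁻¹' W ⊆ N := by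
  obtain ⟨N', hN', rfl⟩ := isOpen_induced_iff.1 hN
  obtain ⟨I, u, hu, hsub⟩ := isOpen_pi_iff.1 hN' x.1 hx
  let j := I.sup id
  have hij : ∀ i ∈ I, i ≤ j := fun i hi => Finset.le_sup (f := id) hi
  refine ⟨j, ⋂ i : I, ζ.comp (hij i i.2) ⁻¹' u i, ?_, ?_, ?_⟩
  · exact isOpen_iInter_of_finite fun i => (hu i i.2).1.preimage (hs.continuous_comp _)
  · refine mem_iInter.2 fun i => ?_
    rw [mem_preimage, comp_proj]
    exact (hu i i.2).2
  · intro z hz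
    refine hsub fun i hi => ?_
    have := mem_iInter.1 hz ⟨i, hi⟩
    rw [mem_preimage, comp_proj] at this
    exact this

theorem IsSplitSequence.isMinimal {n : ℕ} (hsplit : ζ.IsSplitSequence n)
    (hproper : ζ.IsProper) (hstab : ζ.IsStabilized) (hmingle : ζ.IsFullyMingling) :
    ζ.IsMinimal := by
  rintro _ ⟨x, hx, rfl⟩
  -- The leaf of `x` contains a point `y` over no optimal point.
  obtain ⟨y, hy, hxy⟩ : ∃ y, ζ.proj 0 y ∉ ζ.overOptimal 0 ∧ ζ.LeafChain x y := by
    by_cases hxO : ζ.proj 0 x ∈ ζ.overOptimal 0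
    · obtain ⟨V, hV, hxV⟩ := hsplit.exists_isOptimalStarNhd_mem hproper hxO
      have hQ := hsplit.isOptimalLeafSegment hproper hstab hx hxO hV hxV
      have hxQ := mem_pathComponentIn_self (F := ζ.proj 0 ⁻¹' V) hxV
      obtain ⟨y, hyQ, hy⟩ := hsplit.exists_mem_notMem_overOptimal hproper hQ hxQ
      exact ⟨y, hy, hQ.leafChain hxQ hyQ⟩
    · obtain ⟨Q, hQ, hxQ⟩ := hsplit.exists_optimalLeafSegment_mem hproper hstab hmingle hxO
      exact ⟨x, hxO, hQ.leafChain hxQ hxQ⟩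
  rw [dense_iff_inter_open]
  rintro N hN ⟨x₀, hx₀⟩
  obtain ⟨j, W, hW, hx₀W, hWN⟩ := hsplit.exists_proj_preimage_subset hN hx₀
  obtain ⟨e', t', ht', ht'W⟩ := (hsplit.core j).exists_chart_mem hW hx₀W
  obtain ⟨k, hjk, hmin⟩ := hmingle j
  -- At level `k` the leaf runs through the edge of `y`, and so it enters the edge `e'` of level `j`.
  have hyk : ζ.proj k y ∉ (ζ.G k).vert := fun h =>
    hy (proj_zero_mem_overOptimal.2 (mem_overOptimal_of_mem_vert h))
  obtain ⟨e, s, hs, hsy⟩ := exists_edgeInterior hyk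
  obtain ⟨q, ⟨_, ⟨t, ht, rfl⟩, rfl⟩, t'', ht'', htq⟩ := hmin e e'
  obtain ⟨z, hz, hxz⟩ := hsplit.exists_leafChain_chart hproper hstab hxy hs hsy.symm ht
  obtain ⟨z', hz', hxz'⟩ := hsplit.exists_leafChain_chart hproper hstab hxz ht''
    (by rw [← comp_proj hjk.le, hz, htq]) ht'
  refine ⟨z', hWN ?_, hsplit.notMem_sing hproper hstab ht' hz', hxz'.leafEquiv⟩
  rw [mem_preimage, hz']
  exact ht'W

end GraphSequence
end Solenoids

theorem mainTheorem4 (ζ : Solenoids.GraphSequence) (n : ℕ) (hsplit : ζ.IsSplitSequence n)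
    (hproper : ζ.IsProper) (hstab : ζ.IsStabilized) (hmingle : ζ.IsFullyMingling) :
    ζ.IsMinimal := by
  exact hsplit.isMinimal hproper hstab hmingle
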